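/- Let $a\in C([0,1])\cap C^1(]0,1])$ satisfy $a(0)=0$, $a>0$ on $]0,1]$, $\mu_a:=\sup_{0<x\le 1}\frac{x|a'(x)|}{a(x)}<2$ and $a\in C^{[\mu_a]}([0,1])$, where $[\cdot]$ is the integer part. Put $C_a=\frac1{a(1)}\min\{4,\frac1{2-\mu_a}\}$. Let $V^1_a(0,1)$ be the space of all $u\in L^2(0,1)$ that are locally absolutely continuous in $]0,1]$ with $\sqrt a\,u'\in L^2(0,1)$. Let $H^1_a(0,1)$ be the space of all $u\in V^1_a(0,1)$ with $u(1)=0$ and, if $\mu_a<1$, also $u(0)=0$, normed by $(\int_0^1 a|u'|^2dx)^{1/2}$. Let $H^2_a(0,1)$ be the space of all $u\in H^1_a(0,1)$ with $au'\in H^1(0,1)$. On $\mathcal H_0=H^1_a(0,1)\times L^2(0,1)$, with scalar product $\langle (u,v),(\tilde u,\tilde v)\rangle=\int_0^1(v\tilde v+a u'\tilde u')dx$, let $A(u,v)=(v,(au')')$ with domain $D(A)=H^2_a(0,1)\times H^1_a(0,1)$, and let $e^{tA}$ be the strongly continuous contraction semigroup generated by $A$. A function $u\in C^1([0,\infty[;L^2(0,1))\cap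 C([0,\infty[;H^1_a(0,1))$ is the mild solution, with initial data $(u_0,u_1)\in\mathcal H_0$, of $$u_{tt}-(a(x)u_x)_x=0 \ \text{ in } ]0,\infty[\times]0,1[,\qquad u(t,1)=0,\qquad \begin{cases}u(t,0)=0&\text{if }\mu_a\in[0,1[,\\ \lim_{x\downarrow0}a(x)u_x(t,x)=0&\text{if }\mu_a\in[1,2[,\end{cases}$$ if $(u(t),u_t(t))=e^{tA}(u_0,u_1)$ for all $t\ge0$; it is classical if $(u_0,u_1)\in D(A)$. Its energy is $E_u(t)=\frac12\int_0^1(u_t^2+a\,u_x^2)(t,x)\,dx$. For a mild solution, $u_x(\cdot,1)$ denotes the limit in $L^2(0,T)$, for every $T\ge 0$, of the normal derivatives $u^n_x(\cdot,1)$ of classical solutions $u^n$ whose initial data converge to $(u_0,u_1)$ in $\mathcal H_0$. **Theorem.** For every mild solution $u$, the trace $u_x(\cdot,1)$ exists and belongs to $L^2(0,T)$ for every $T\ge0$, and for every $T\ge 0$ $$a(1)\int_0^T u_x(t,1)^2\,dt\ \ge\ \Big\{(2-\mu_a)T-\frac{4}{\min\{1,a(1)\}}-2\mu_a\sqrt{C_a}\Big\}E_u(0).$$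 Call $C>0$ an observability constant in time $T$ if $\int_0^T u_x(t,1)^2\,dt\ge C\,E_u(0)$ for all mild solutions $u$, call the equation observable in time $T$ if such a constant exists, and let $C_T$ be the supremum of all observability constants in time $T$. Then for every $$T>T_a:=\frac1{2-\mu_a}\Big(\frac4{\min\{1,a(1)\}}+2\mu_a\sqrt{C_a}\Big)$$ the equation is observable in time $T$, and $$C_T\ \ge\ \frac1{a(1)}\Big\{(2-\mu_a)T-\frac4{\min\{1,a(1)\}}-2\mu_a\sqrt{C_a}\Big\}.$$ -/

import Mathlib

open MeasureTheory Set Filter Topology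

namespace DegWave

noncomputable section

/-! ### The diffusion coefficient -/

/-- The degeneracy parameter `μ_a = sup_{0 < x ≤ 1} x |a'(x)| / a(x)`; the derivative at `x = 1` is
the one-sided one. -/
def mu (a : ℝ → ℝ) : ℝ :=
  sSup ((fun x : ℝ => x * |derivWithin a (Ioc 0 1) x| / a x) '' Ioc 0 1)

/-- The standing assumptions on the coefficient: `a ∈ C([0,1]) ∩ C¹(]0,1])`, `a > 0` on `]0,1]`,
`a(0) = 0`, `μ_a < 2` (with `μ_a` a genuine supremum) and `a ∈ C^{[μ_a]}([0,1])`. -/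
structure IsDegenerateCoeff (a : ℝ → ℝ) : Prop where
  continuousOn : ContinuousOn a (Icc 0 1)
  contDiffOn : ContDiffOn ℝ 1 a (Ioc 0 1)
  pos : ∀ x ∈ Ioc (0 : ℝ) 1, 0 < a x
  zero : a 0 = 0
  bddAbove : BddAbove ((fun x : ℝ => x * |derivWithin a (Ioc 0 1) x| / a x) '' Ioc 0 1)
  mu_lt_two : mu a < 2
  contDiffOn_floor : ContDiffOn ℝ ((⌊mu a⌋₊ : ℕ) : WithTop ℕ∞) a (Icc 0 1)

/-- The constant `C_a = (1 / a(1)) min {4, 1 / (2 - μ_a)}`. -/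
def poincareConst (a : ℝ → ℝ) : ℝ := 1 / a 1 * min 4 (1 / (2 - mu a))

/-! ### Function spaces -/

/-- Lebesgue measure on the interval `(0,1)`. -/
abbrev vol01 : Measure ℝ := volume.restrict (Ioo 0 1)

/-- The space `L²(0,1)`. -/
abbrev L2 : Type := Lp ℝ 2 vol01

/-- `f` belongs to `V¹_a(0,1)`: it is in `L²(0,1)`, locally absolutely continuous in `]0,1]`, and
`√a f' ∈ L²(0,1)`. Only the values of `f` on `]0,1]` matter. -/
structure IsV1 (a f : ℝ → ℝ) : Prop where
  memLp : MemLp f 2 vol01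
  ac : ∀ ε ∈ Ioo (0 : ℝ) 1, AbsolutelyContinuousOnInterval f ε 1
  memLp_deriv : MemLp (fun x => √(a x) * deriv f x) 2 vol01

/-- `f` belongs to `H¹_a(0,1)`: it is in `V¹_a(0,1)`, `f(1) = 0` and, in the weakly degenerate case
`μ_a < 1`, moreover `f(0) = 0` (as the value at `0` of the continuous extension). -/
structure IsH1 (a f : ℝ → ℝ) : Prop extends IsV1 a f where
  at_one : f 1 = 0
  at_zero : mu a < 1 → Tendsto f (𝓝[>] 0) (𝓝 0)

lemma ae_differentiableAt_of_ac {f : ℝ → ℝ}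
    (hf : ∀ ε ∈ Ioo (0 : ℝ) 1, AbsolutelyContinuousOnInterval f ε 1) :
    ∀ᵐ x ∂vol01, DifferentiableAt ℝ f x := by
  have h : ∀ n : ℕ, ∀ᵐ x : ℝ, x ∈ uIcc (1 / ((n : ℝ) + 2)) 1 → DifferentiableAt ℝ f x := by
    intro n
    refine (hf _ ⟨by positivity, ?_⟩).ae_differentiableAt
    rw [div_lt_one (by positivity)]
    have : (0 : ℝ) ≤ n := n.cast_nonneg
    linarith
  rw [ae_restrict_iff' measurableSet_Ioo]
  filter_upwards [ae_all_iff.2 h] with x hx hx01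
  obtain ⟨n, hn⟩ := exists_nat_one_div_lt hx01.1
  refine hx n ?_
  have h1 : 1 / ((n : ℝ) + 2) ≤ 1 / ((n : ℝ) + 1) := by
    apply one_div_le_one_div_of_le <;> [positivity; linarith]
  exact mem_uIcc_of_le (h1.trans hn.le) hx01.2.le

lemma IsH1.zero (a : ℝ → ℝ) : IsH1 a (fun _ => 0) where
  memLp := MemLp.zero
  ac ε _ := LipschitzOnWith.absolutelyContinuousOnInterval (K := 0)
    (LipschitzWith.const' (0 : ℝ)).lipschitzOnWith
  memLp_deriv := by simp
  at_one := rfl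
  at_zero _ := tendsto_const_nhds

lemma IsV1.deriv_add {a f g : ℝ → ℝ} (hf : IsV1 a f) (hg : IsV1 a g) :
    (fun x => √(a x) * deriv (f + g) x) =ᵐ[vol01]
      (fun x => √(a x) * deriv f x) + fun x => √(a x) * deriv g x := by
  filter_upwards [ae_differentiableAt_of_ac hf.ac, ae_differentiableAt_of_ac hg.ac] with x h1 h2
  simp [_root_.deriv_add h1 h2, mul_add]

lemma IsV1.deriv_smul {a f : ℝ → ℝ} (c : ℝ) :
    (fun x => √(a x) * deriv (c • f) x) = c • fun x => √(a x) * deriv f x := by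
  funext x
  simp only [Pi.smul_apply, smul_eq_mul, deriv_const_smul_field]
  ring

lemma IsH1.add {a f g : ℝ → ℝ} (hf : IsH1 a f) (hg : IsH1 a g) : IsH1 a (f + g) where
  memLp := hf.memLp.add hg.memLp
  ac ε hε := (hf.ac ε hε).add (hg.ac ε hε)
  memLp_deriv := (memLp_congr_ae (hf.toIsV1.deriv_add hg.toIsV1)).2
    (hf.memLp_deriv.add hg.memLp_deriv)
  at_one := by simp [hf.at_one, hg.at_one]
  at_zero h := by
    have := (hf.at_zero h).add (hg.at_zero h)
    rwa [add_zero] at this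

lemma IsH1.smul {a f : ℝ → ℝ} (c : ℝ) (hf : IsH1 a f) : IsH1 a (c • f) where
  memLp := hf.memLp.const_smul c
  ac ε hε := (hf.ac ε hε).const_mul c
  memLp_deriv := by
    rw [IsV1.deriv_smul]
    exact hf.memLp_deriv.const_smul c
  at_one := by simp [hf.at_one]
  at_zero h := by
    have := (hf.at_zero h).const_mul c
    rwa [mul_zero] at this

/-- `H¹_a(0,1)` as a subspace of `L²(0,1)`. -/
def H1Sub (a : ℝ → ℝ) : Submodule ℝ L2 where
  carrier := {u | ∃ f : ℝ → ℝ, u =ᵐ[vol01] f ∧ IsH1 a f}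
  zero_mem' := ⟨fun _ => 0, Lp.coeFn_zero _ _ _, IsH1.zero a⟩
  add_mem' := by
    rintro u v ⟨f, huf, hf⟩ ⟨g, hvg, hg⟩
    exact ⟨f + g, (Lp.coeFn_add u v).trans (huf.add hvg), hf.add hg⟩
  smul_mem' := by
    rintro c u ⟨f, huf, hf⟩
    exact ⟨c • f, (Lp.coeFn_smul c u).trans (huf.const_smul c), hf.smul c⟩

/-- The space `H¹_a(0,1)`, whose norm (defined below) is `|u|_{1,a} = (∫ a |u'|²)^{1/2}`. -/
def H1 {a : ℝ → ℝ} (_ha : IsDegenerateCoeff a) : Type := ↥(H1Sub a)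

variable {a : ℝ → ℝ} {ha : IsDegenerateCoeff a}

instance : AddCommGroup (H1 ha) := inferInstanceAs (AddCommGroup ↥(H1Sub a))

instance : Module ℝ (H1 ha) := inferInstanceAs (Module ℝ ↥(H1Sub a))

/-- The inclusion `H¹_a(0,1) → L²(0,1)`. -/
def H1.toL2 : H1 ha →ₗ[ℝ] L2 := (H1Sub a).subtype

/-- The representative of `u ∈ H¹_a(0,1)` that is locally absolutely continuous in `]0,1]`; it is
unique on `]0,1]`. -/
def H1.rep (u : H1 ha) : ℝ → ℝ := Classical.choose u.2

lemma H1.toL2_ae_eq (u : H1 ha) : u.toL2 =ᵐ[vol01] u.rep := (Classical.choose_spec u.2).1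

lemma H1.isH1_rep (u : H1 ha) : IsH1 a u.rep := (Classical.choose_spec u.2).2

lemma eqOn_of_ae_eq {f g : ℝ → ℝ} (h : f =ᵐ[vol01] g)
    (hf : ∀ ε ∈ Ioo (0 : ℝ) 1, AbsolutelyContinuousOnInterval f ε 1)
    (hg : ∀ ε ∈ Ioo (0 : ℝ) 1, AbsolutelyContinuousOnInterval g ε 1) : EqOn f g (Ioo 0 1) := by
  have key : ∀ {f : ℝ → ℝ}, (∀ ε ∈ Ioo (0 : ℝ) 1, AbsolutelyContinuousOnInterval f ε 1) →
      ContinuousOn f (Ioo 0 1) := by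
    intro f hf x hx
    have h2 : x / 2 ∈ Ioo (0 : ℝ) 1 := ⟨by linarith [hx.1], by linarith [hx.1, hx.2]⟩
    have h3 := (hf _ h2).continuousOn
    rw [uIcc_of_le h2.2.le] at h3
    exact (h3.continuousAt (Icc_mem_nhds (by linarith [hx.1]) hx.2)).continuousWithinAt
  exact Measure.eqOn_open_of_ae_eq h isOpen_Ioo (key hf) (key hg)

lemma H1.deriv_rep_eq (u : H1 ha) {f : ℝ → ℝ} (hf : IsV1 a f) (h : u.toL2 =ᵐ[vol01] f) :
    EqOn (deriv u.rep) (deriv f) (Ioo 0 1) := by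
  have := eqOn_of_ae_eq (u.toL2_ae_eq.symm.trans h) u.isH1_rep.ac hf.ac
  intro x hx
  exact (this.eventuallyEq_of_mem (isOpen_Ioo.mem_nhds hx)).deriv_eq

/-- The linear map `u ↦ √a u'` from `H¹_a(0,1)` to `L²(0,1)`. -/
def H1.grad : H1 ha →ₗ[ℝ] L2 where
  toFun u := u.isH1_rep.memLp_deriv.toLp _
  map_add' u v := by
    rw [← MemLp.toLp_add, MemLp.toLp_eq_toLp_iff]
    refine EventuallyEq.trans ?_ (u.isH1_rep.toIsV1.deriv_add v.isH1_rep.toIsV1)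
    have h : (u + v).toL2 =ᵐ[vol01] u.rep + v.rep := by
      rw [map_add]
      exact (Lp.coeFn_add _ _).trans (u.toL2_ae_eq.add v.toL2_ae_eq)
    have h' := (u + v).deriv_rep_eq (u.isH1_rep.add v.isH1_rep).toIsV1 h
    filter_upwards [ae_restrict_mem measurableSet_Ioo] with x hx
    rw [h' hx]
  map_smul' c u := by
    simp only [RingHom.id_apply]
    rw [← MemLp.toLp_const_smul, MemLp.toLp_eq_toLp_iff, ← IsV1.deriv_smul]
    have h : (c • u).toL2 =ᵐ[vol01] c • u.rep := by
      rw [map_smul]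
      exact (Lp.coeFn_smul _ _).trans (u.toL2_ae_eq.const_smul c)
    have h' := (c • u).deriv_rep_eq (u.isH1_rep.smul c).toIsV1 h
    filter_upwards [ae_restrict_mem measurableSet_Ioo] with x hx
    rw [h' hx]

lemma H1.grad_ae_eq (u : H1 ha) : u.grad =ᵐ[vol01] fun x => √(a x) * deriv u.rep x :=
  MemLp.coeFn_toLp u.isH1_rep.memLp_deriv

lemma H1.grad_injective : Function.Injective (H1.grad (ha := ha)) := by
  rw [← LinearMap.ker_eq_bot, LinearMap.ker_eq_bot']
  intro u hu
  have h0 : ∀ᵐ x ∂vol01, HasDerivAt u.rep 0 x := by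
    have h1 : (fun x => √(a x) * deriv u.rep x) =ᵐ[vol01] 0 :=
      u.grad_ae_eq.symm.trans (by rw [hu]; exact Lp.coeFn_zero _ _ _)
    filter_upwards [h1, ae_differentiableAt_of_ac u.isH1_rep.ac,
      ae_restrict_mem measurableSet_Ioo] with x hx hd hx01
    have hpos : √(a x) ≠ 0 := (Real.sqrt_pos.2 (ha.pos x ⟨hx01.1, hx01.2.le⟩)).ne'
    have : deriv u.rep x = 0 := by simpa [hpos] using hx
    rw [← this]
    exact hd.hasDerivAt
  have hrep : ∀ x ∈ Ioo (0 : ℝ) 1, u.rep x = 0 := by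
    intro x hx
    have hac := u.isH1_rep.ac x hx
    have h2 : ∀ᵐ y : ℝ, y ∈ uIcc x 1 → HasDerivAt u.rep 0 y := by
      rw [ae_restrict_iff' measurableSet_Ioo] at h0
      have h1 : ∀ᵐ y : ℝ, y ≠ 1 := Measure.ae_ne _ _
      filter_upwards [h0, h1] with y hy hy1 hyx
      rw [uIcc_of_le hx.2.le] at hyx
      exact hy ⟨hx.1.trans_le hyx.1, lt_of_le_of_ne hyx.2 hy1⟩
    obtain ⟨C, hC⟩ := hac.const_of_ae_hasDerivAt_zero h2
    rw [hC x left_mem_uIcc, ← hC 1 right_mem_uIcc, u.isH1_rep.at_one]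
  apply Subtype.ext
  apply Lp.ext
  refine u.toL2_ae_eq.trans (EventuallyEq.trans ?_ (Lp.coeFn_zero _ _ _).symm)
  filter_upwards [ae_restrict_mem measurableSet_Ioo] with x hx
  exact hrep x hx

instance : NormedAddCommGroup (H1 ha) :=
  NormedAddCommGroup.induced (H1 ha) L2 H1.grad H1.grad_injective

instance : NormedSpace ℝ (H1 ha) := NormedSpace.induced ℝ (H1 ha) L2 H1.grad

instance : InnerProductSpace ℝ (H1 ha) where
  inner u v := inner ℝ u.grad v.grad
  norm_sq_eq_re_inner u := norm_sq_eq_re_inner (𝕜 := ℝ) u.grad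
  conj_inner_symm u v := inner_conj_symm u.grad v.grad
  add_left u v w := by rw [map_add, inner_add_left]
  smul_left u v c := by rw [map_smul, inner_smul_left]

lemma H1.inner_def (u v : H1 ha) :
    inner ℝ u v = ∫ x in Ioo 0 1, a x * deriv u.rep x * deriv v.rep x := by
  change inner ℝ u.grad v.grad = _
  rw [L2.inner_def]
  refine integral_congr_ae ?_
  filter_upwards [u.grad_ae_eq, v.grad_ae_eq, ae_restrict_mem measurableSet_Ioo] with x hu hv hx
  have := Real.mul_self_sqrt (ha.pos x ⟨hx.1, hx.2.le⟩).le
  simp only [hu, hv, RCLike.inner_apply, conj_trivial]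
  linear_combination deriv u.rep x * deriv v.rep x * this

/-- The (one-sided) derivative `u_x(1)`; it exists whenever `a u'` is in `H¹(0,1)`. -/
def H1.normalDeriv (u : H1 ha) : ℝ := derivWithin u.rep (Ioc 0 1) 1

/-- The energy space `H¹_a(0,1) × L²(0,1)`, with scalar product
`⟨(u,v),(ũ,ṽ)⟩ = ∫ (v ṽ + a u' ũ')`. -/
abbrev EnergySpace {a : ℝ → ℝ} (ha : IsDegenerateCoeff a) : Type := WithLp 2 (H1 ha × L2)

/-! ### The wave operator and its semigroup -/

/-- `au' ∈ H¹(0,1)` with `(au')' = w`: the function `a u'` has a representative which is absolutely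
continuous on `[0,1]` and whose derivative is `w ∈ L²(0,1)`. -/
def HasFluxDeriv (u : H1 ha) (w : L2) : Prop :=
  ∃ g : ℝ → ℝ, AbsolutelyContinuousOnInterval g 0 1 ∧
    (fun x => a x * deriv u.rep x) =ᵐ[vol01] g ∧ w =ᵐ[vol01] deriv g

/-- The graph of the operator `A(u,v) = (v,(au')')` with domain `D(A) = H²_a(0,1) × H¹_a(0,1)`:
`WaveOp ha U W` says that `U ∈ D(A)` and `AU = W`. -/
def WaveOp {a : ℝ → ℝ} (ha : IsDegenerateCoeff a) (U W : EnergySpace ha) : Prop :=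
  U.snd = W.fst.toL2 ∧ HasFluxDeriv U.fst W.snd

/-- `S` is a strongly continuous contraction semigroup on `X`; only times `t ≥ 0` matter. -/
structure IsContractionSemigroup {X : Type*} [NormedAddCommGroup X] [NormedSpace ℝ X]
    (S : ℝ → X →L[ℝ] X) : Prop where
  zero : S 0 = ContinuousLinearMap.id ℝ X
  add : ∀ s t : ℝ, 0 ≤ s → 0 ≤ t → S (s + t) = (S s).comp (S t)
  norm_le : ∀ t : ℝ, 0 ≤ t → ‖S t‖ ≤ 1
  tendsto : ∀ x : X, Tendsto (fun t => S t x) (𝓝[>] 0) (𝓝 x)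

/-- The infinitesimal generator of `S` is the operator with graph `G`. -/
def IsGenerator {X : Type*} [NormedAddCommGroup X] [NormedSpace ℝ X]
    (S : ℝ → X →L[ℝ] X) (G : X → X → Prop) : Prop :=
  ∀ x y : X, G x y ↔ Tendsto (fun h : ℝ => h⁻¹ • (S h x - x)) (𝓝[>] 0) (𝓝 y)

/-- The time derivative `u_t(t) ∈ L²(0,1)` (one-sided at `t = 0`). -/
def timeDeriv (u : ℝ → H1 ha) (t : ℝ) : L2 := derivWithin (fun s => (u s).toL2) (Ici 0) t

/-- `u ∈ C¹([0,∞[; L²(0,1)) ∩ C([0,∞[; H¹_a(0,1))` is the mild solution with initial data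
`(u₀,u₁) ∈ H¹_a(0,1) × L²(0,1)`: `(u(t),u_t(t)) = e^{tA}(u₀,u₁)` for all `t ≥ 0`, where `e^{tA}` is
the contraction semigroup generated by `A`. -/
structure IsMildSolution {a : ℝ → ℝ} (ha : IsDegenerateCoeff a) (u₀ : H1 ha) (u₁ : L2)
    (u : ℝ → H1 ha) : Prop where
  contDiffOn : ContDiffOn ℝ 1 (fun t => (u t).toL2) (Ici 0)
  continuousOn : ContinuousOn u (Ici 0)
  semigroup : ∃ S : ℝ → EnergySpace ha →L[ℝ] EnergySpace ha,
    IsContractionSemigroup S ∧ IsGenerator S (WaveOp ha) ∧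
      ∀ t : ℝ, 0 ≤ t → WithLp.toLp 2 (u t, timeDeriv u t) = S t (WithLp.toLp 2 (u₀, u₁))

/-- A classical solution: a mild solution with initial data in `D(A)`. -/
def IsClassicalSolution {a : ℝ → ℝ} (ha : IsDegenerateCoeff a) (u₀ : H1 ha) (u₁ : L2)
    (u : ℝ → H1 ha) : Prop :=
  IsMildSolution ha u₀ u₁ u ∧ ∃ W, WaveOp ha (WithLp.toLp 2 (u₀, u₁)) W

/-- The energy `E_u(t) = ½ ∫₀¹ (u_t² + a u_x²) dx`. -/
def energy (u : ℝ → H1 ha) (t : ℝ) : ℝ :=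
  1 / 2 * ∫ x in Ioo 0 1, ((timeDeriv u t x) ^ 2 + a x * (deriv (u t).rep x) ^ 2)

/-- `g = u_x(·,1)` for the mild solution `u` with data `(u₀,u₁)`: `g ∈ L²(0,T)` for all `T`, and `g`
is the limit in `L²(0,T)`, for all `T`, of the normal derivatives at `x = 1` of classical solutions
whose initial data converge to `(u₀,u₁)` in the energy space. -/
structure IsNormalTrace {a : ℝ → ℝ} (ha : IsDegenerateCoeff a) (u₀ : H1 ha) (u₁ : L2)
    (g : ℝ → ℝ) : Prop where
  memLp : ∀ T : ℝ, 0 ≤ T → MemLp g 2 (volume.restrict (Ioc 0 T))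
  approx : ∃ (p : ℕ → H1 ha) (q : ℕ → L2) (v : ℕ → ℝ → H1 ha),
    (∀ n, IsClassicalSolution ha (p n) (q n) (v n)) ∧
    Tendsto p atTop (𝓝 u₀) ∧ Tendsto q atTop (𝓝 u₁) ∧
    ∀ T : ℝ, 0 ≤ T → Tendsto
      (fun n => eLpNorm (fun t => (v n t).normalDeriv - g t) 2 (volume.restrict (Ioc 0 T)))
      atTop (𝓝 0)

/-! ### Observability -/

/-- `C > 0` is an observability constant in time `T`: every mild solution satisfies
`∫₀ᵀ u_x(t,1)² dt ≥ C E_u(0)`. -/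
def IsObservabilityConstant {a : ℝ → ℝ} (ha : IsDegenerateCoeff a) (T C : ℝ) : Prop :=
  0 < C ∧ ∀ (u₀ : H1 ha) (u₁ : L2) (u : ℝ → H1 ha) (g : ℝ → ℝ),
    IsMildSolution ha u₀ u₁ u → IsNormalTrace ha u₀ u₁ g →
      C * energy u 0 ≤ ∫ t in (0 : ℝ)..T, g t ^ 2

/-- The equation is observable in time `T` via the normal derivative at `x = 1`. -/
def IsObservable {a : ℝ → ℝ} (ha : IsDegenerateCoeff a) (T : ℝ) : Prop :=
  ∃ C : ℝ, IsObservabilityConstant ha T C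

/-- The supremum `C_T` of all observability constants in time `T`, in the extended reals. -/
def observabilityConst {a : ℝ → ℝ} (ha : IsDegenerateCoeff a) (T : ℝ) : EReal :=
  sSup ((fun C : ℝ => (C : EReal)) '' {C : ℝ | IsObservabilityConstant ha T C})

/-- The time `T_a = (1 / (2 - μ_a)) (4 / min {1, a(1)} + 2 μ_a √C_a)`. -/
def observabilityTime (a : ℝ → ℝ) : ℝ :=
  1 / (2 - mu a) * (4 / min 1 (a 1) + 2 * mu a * √(poincareConst a))

end

end DegWave

/-!
Test the wave equation of a classical solution against the multiplier `x u_x`. Integrating by parts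
in `x`, and using `x |a'| ≤ μ_a a`, one finds
`a(1) u_x(t,1)² ≥ d/dt [2 ∫ x u_x u_t + (μ_a / 2) ∫ u u_t] + (1 - μ_a / 2) ‖(u, u_t)‖²`,
where the term `∫ u u_t` converts `∫ u_t²` into `∫ a u_x²`. The energy is conserved, and the bracket
is bounded by it: `x² ≤ a / a(1)` because `a x⁻²` is nonincreasing, and `∫ u² ≤ C_a ∫ a u_x²` by the
Hardy–Poincaré inequality. Integrating in time gives the observability inequality. Estimating the
same identity from above bounds `∫ u_x(·,1)²` by the energy; since the domain of the generator is
dense, the normal trace extends to mild solutions, and with it the inequality.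
-/

namespace DegWave

/-! ### Square-integrable functions -/

section L2

variable {α : Type*} [MeasurableSpace α] {μ : Measure α}

lemma inner_eq_integral {u v : Lp ℝ 2 μ} {f g : α → ℝ} (hf : u =ᵐ[μ] f) (hg : v =ᵐ[μ] g) :
    inner ℝ u v = ∫ x, f x * g x ∂μ := by
  rw [L2.inner_def]
  refine integral_congr_ae ?_
  filter_upwards [hf, hg] with x h1 h2
  simp [h1, h2, mul_comm]

lemma norm_sq_eq_integral {u : Lp ℝ 2 μ} {f : α → ℝ} (hf : u =ᵐ[μ] f) :
    ‖u‖ ^ 2 = ∫ x, f x ^ 2 ∂μ := by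
  rw [← real_inner_self_eq_norm_sq, inner_eq_integral hf hf]
  simp only [pow_two]

lemma memLp_of_ae_eq {u : Lp ℝ 2 μ} {f : α → ℝ} (hf : u =ᵐ[μ] f) : MemLp f 2 μ :=
  (memLp_congr_ae hf).1 (Lp.memLp u)

lemma sq_integral_mul_le {f g : α → ℝ} (hf : MemLp f 2 μ) (hg : MemLp g 2 μ) :
    (∫ x, f x * g x ∂μ) ^ 2 ≤ (∫ x, f x ^ 2 ∂μ) * ∫ x, g x ^ 2 ∂μ := by
  rw [← inner_eq_integral hf.coeFn_toLp hg.coeFn_toLp, ← norm_sq_eq_integral hf.coeFn_toLp,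
    ← norm_sq_eq_integral hg.coeFn_toLp, ← mul_pow]
  exact sq_le_sq.2 ((abs_real_inner_le_norm _ _).trans (le_abs_self _))

lemma sq_intervalIntegral_mul_le {f g : ℝ → ℝ} {x y : ℝ} (hxy : x ≤ y)
    (hf : MemLp f 2 (volume.restrict (Ioc x y))) (hg : MemLp g 2 (volume.restrict (Ioc x y))) :
    (∫ z in x..y, f z * g z) ^ 2 ≤ (∫ z in x..y, f z ^ 2) * ∫ z in x..y, g z ^ 2 := by
  simpa only [intervalIntegral.integral_of_le hxy] using sq_integral_mul_le hf hg

end L2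

/-! ### The coefficient -/

namespace IsDegenerateCoeff

variable {a : ℝ → ℝ}

lemma hasDerivAt (ha : IsDegenerateCoeff a) {x : ℝ} (hx : x ∈ Ioo (0 : ℝ) 1) :
    HasDerivAt a (deriv a x) x :=
  ((ha.contDiffOn.differentiableOn one_ne_zero x ⟨hx.1, hx.2.le⟩).differentiableAt
    (Ioc_mem_nhds hx.1 hx.2)).hasDerivAt

lemma continuousOn_Ioc (ha : IsDegenerateCoeff a) : ContinuousOn a (Ioc 0 1) :=
  ha.contDiffOn.continuousOn

lemma pos_one (ha : IsDegenerateCoeff a) : 0 < a 1 := ha.pos 1 ⟨one_pos, le_rfl⟩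

lemma min_one_pos (ha : IsDegenerateCoeff a) : 0 < min 1 (a 1) := lt_min one_pos ha.pos_one

lemma two_sub_mu_pos (ha : IsDegenerateCoeff a) : 0 < 2 - mu a := sub_pos.2 ha.mu_lt_two

lemma mul_abs_deriv_le (ha : IsDegenerateCoeff a) {x : ℝ} (hx : x ∈ Ioo (0 : ℝ) 1) :
    x * |deriv a x| ≤ mu a * a x := by
  have h := le_csSup ha.bddAbove (mem_image_of_mem _ (Ioo_subset_Ioc_self hx))
  rw [derivWithin_of_mem_nhds (Ioc_mem_nhds hx.1 hx.2)] at h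
  exact (div_le_iff₀ (ha.pos x ⟨hx.1, hx.2.le⟩)).1 h

lemma mu_nonneg (ha : IsDegenerateCoeff a) : 0 ≤ mu a := by
  have hhalf : (1 / 2 : ℝ) ∈ Ioo (0 : ℝ) 1 := by norm_num
  have h : 0 ≤ mu a * a (1 / 2) := le_trans (by positivity) (ha.mul_abs_deriv_le hhalf)
  exact nonneg_of_mul_nonneg_left h (ha.pos _ (Ioo_subset_Ioc_self hhalf))

lemma antitoneOn_mul_rpow_neg_mu (ha : IsDegenerateCoeff a) :
    AntitoneOn (fun x => a x * x ^ (-mu a)) (Ioc 0 1) := by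
  have hd : ∀ x ∈ Ioo (0 : ℝ) 1, HasDerivAt (fun x => a x * x ^ (-mu a))
      ((x * deriv a x - mu a * a x) * x ^ (-mu a - 1)) x := fun x hx => by
    have hx1 : x ^ (-mu a) = x * x ^ (-mu a - 1) := by
      rw [Real.rpow_sub_one hx.1.ne', mul_div_cancel₀ _ hx.1.ne']
    refine ((ha.hasDerivAt hx).fun_mul
      (Real.hasDerivAt_rpow_const (p := -mu a) (Or.inl hx.1.ne'))).congr_deriv ?_
    rw [hx1]
    ring
  refine antitoneOn_of_deriv_nonpos (convex_Ioc 0 1) ?_ ?_ ?_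
  · exact ha.continuousOn_Ioc.mul fun x hx =>
      (Real.continuousAt_rpow_const x _ (Or.inl hx.1.ne')).continuousWithinAt
  · rw [interior_Ioc]
    exact fun x hx => (hd x hx).differentiableAt.differentiableWithinAt
  · rw [interior_Ioc]
    intro x hx
    rw [(hd x hx).deriv]
    have hle : x * deriv a x ≤ mu a * a x :=
      (mul_le_mul_of_nonneg_left (le_abs_self _) hx.1.le).trans (ha.mul_abs_deriv_le hx)
    exact mul_nonpos_of_nonpos_of_nonneg (sub_nonpos.2 hle) (Real.rpow_nonneg hx.1.le _)

lemma mul_rpow_le (ha : IsDegenerateCoeff a) {x : ℝ} (hx : x ∈ Ioc (0 : ℝ) 1) :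
    a 1 * x ^ mu a ≤ a x := by
  have h := ha.antitoneOn_mul_rpow_neg_mu hx ⟨one_pos, le_rfl⟩ hx.2
  simp only [Real.one_rpow, mul_one] at h
  have hpow : 0 < x ^ mu a := Real.rpow_pos_of_pos hx.1 _
  calc a 1 * x ^ mu a ≤ a x * x ^ (-mu a) * x ^ mu a := by gcongr
    _ = a x := by rw [mul_assoc, ← Real.rpow_add hx.1, neg_add_cancel, Real.rpow_zero, mul_one]

lemma mul_sq_le (ha : IsDegenerateCoeff a) {x : ℝ} (hx : x ∈ Ioc (0 : ℝ) 1) :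
    a 1 * x ^ 2 ≤ a x := by
  refine le_trans ?_ (ha.mul_rpow_le hx)
  have := ha.pos_one
  gcongr
  rw [← Real.rpow_natCast]
  exact Real.rpow_le_rpow_of_exponent_ge hx.1 hx.2 (by exact_mod_cast ha.mu_lt_two.le)

lemma exists_le_mul (ha : IsDegenerateCoeff a) (h : 1 ≤ mu a) :
    ∃ K : ℝ, ∀ x ∈ Ioc (0 : ℝ) 1, a x ≤ K * x := by
  have hfloor : ⌊mu a⌋₊ = 1 := by
    rw [Nat.floor_eq_iff ha.mu_nonneg]
    exact ⟨by exact_mod_cast h, by norm_num; exact ha.mu_lt_two⟩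
  have hC1 := ha.contDiffOn_floor
  rw [hfloor] at hC1
  obtain ⟨K, hK⟩ := ContDiffOn.exists_lipschitzOnWith (by exact_mod_cast hC1) (by decide)
    (convex_Icc _ _) isCompact_Icc
  refine ⟨K, fun x hx => ?_⟩
  have hdist := hK.dist_le_mul x ⟨hx.1.le, hx.2⟩ 0 ⟨le_rfl, zero_le_one⟩
  rw [ha.zero, Real.dist_eq, Real.dist_eq, sub_zero, sub_zero, abs_of_pos hx.1] at hdist
  exact (le_abs_self _).trans hdist

lemma ac_inv (ha : IsDegenerateCoeff a) {ε : ℝ} (hε : ε ∈ Ioo (0 : ℝ) 1) :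
    AbsolutelyContinuousOnInterval (fun x => (a x)⁻¹) ε 1 := by
  have hs : Icc ε 1 ⊆ Ioc (0 : ℝ) 1 := fun x hx => ⟨hε.1.trans_le hx.1, hx.2⟩
  refine ContDiffOn.absolutelyContinuousOnInterval ?_
  rw [uIcc_of_le hε.2.le]
  exact (ha.contDiffOn.mono hs).inv fun x hx => (ha.pos x (hs hx)).ne'

lemma sqrt_pos (ha : IsDegenerateCoeff a) {x : ℝ} (hx : x ∈ Ioo (0 : ℝ) 1) : 0 < √(a x) :=
  Real.sqrt_pos.2 (ha.pos x ⟨hx.1, hx.2.le⟩)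

lemma continuousOn_inv_sqrt (ha : IsDegenerateCoeff a) :
    ContinuousOn (fun x => (√(a x))⁻¹) (Ioc 0 1) :=
  ha.continuousOn_Ioc.sqrt.inv₀ fun x hx => (Real.sqrt_pos.2 (ha.pos x hx)).ne'

lemma aestronglyMeasurable_inv_sqrt (ha : IsDegenerateCoeff a) :
    AEStronglyMeasurable (fun x => (√(a x))⁻¹) vol01 :=
  (ha.continuousOn_inv_sqrt.mono Ioo_subset_Ioc_self).aestronglyMeasurable measurableSet_Ioo

end IsDegenerateCoeff

/-! ### Local absolute continuity in `]0,1]` -/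

lemma ae_vol01 {p : ℝ → Prop} (h : ∀ x ∈ Ioo (0 : ℝ) 1, p x) : ∀ᵐ x ∂vol01, p x :=
  ae_restrict_of_forall_mem measurableSet_Ioo h

/-- Local absolute continuity in `]0,1]`, in the form used in the definition of `V¹_a(0,1)`. -/
abbrev LocAC (f : ℝ → ℝ) : Prop :=
  ∀ ε ∈ Ioo (0 : ℝ) 1, AbsolutelyContinuousOnInterval f ε 1

lemma tendsto_intervalIntegral_left {φ : ℝ → ℝ} {b c : ℝ} (hbc : b < c)
    (hφ : IntegrableOn φ (Ioo b c)) :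
    Tendsto (fun x => ∫ y in x..c, φ y) (𝓝[>] b) (𝓝 (∫ y in Ioo b c, φ y)) := by
  have hint : IntegrableOn φ (uIcc b c) := by
    rwa [uIcc_of_le hbc.le, integrableOn_Icc_iff_integrableOn_Ioo]
  have h := intervalIntegral.continuousOn_primitive_interval_left hint b left_mem_uIcc
  rw [ContinuousWithinAt, intervalIntegral.integral_of_le hbc.le,
    integral_Ioc_eq_integral_Ioo, uIcc_of_le hbc.le] at h
  exact h.mono_left (nhdsWithin_le_iff.2 (Icc_mem_nhdsGT hbc))

-- Near `0` the quotient `F x / x` would otherwise dominate a multiple of `1 / x`.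
lemma eq_zero_of_tendsto_of_integrable_div {F : ℝ → ℝ} {L b : ℝ} (hb : 0 < b)
    (hF : Tendsto F (𝓝[>] 0) (𝓝 L)) (hdiv : IntegrableOn (fun x => F x / x) (Ioo 0 b)) :
    L = 0 := by
  by_contra hL
  have hL' : 0 < |L| := abs_pos.2 hL
  have hlarge : ∀ᶠ x in 𝓝[>] (0 : ℝ), |L| / 2 < |F x| :=
    hF.abs.eventually_const_lt (half_lt_self hL')
  obtain ⟨δ, hδ, hsub⟩ := mem_nhdsGT_iff_exists_Ioo_subset.1
    (inter_mem hlarge (Ioo_mem_nhdsGT hb))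
  have hδ0 : (0 : ℝ) < δ := hδ
  have hinv : IntervalIntegrable (fun x : ℝ => x⁻¹) volume 0 δ := by
    rw [intervalIntegrable_iff_integrableOn_Ioo_of_le hδ0.le]
    have hdiv' : IntegrableOn (fun x => F x / x) (Ioo 0 δ) :=
      hdiv.mono_set fun x hx => (hsub hx).2
    refine (hdiv'.norm.const_mul (2 / |L|)).mono' measurable_inv.aestronglyMeasurable ?_
    refine ae_restrict_of_forall_mem measurableSet_Ioo fun x hx => ?_
    have hx1 : |L| / 2 < |F x| := (hsub hx).1
    rw [norm_inv, norm_div, Real.norm_eq_abs (F x), ← mul_div_assoc, ← one_div]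
    gcongr
    rw [div_mul_eq_mul_div, le_div_iff₀ hL']
    linarith
  rcases intervalIntegrable_inv_iff.1 hinv with h | h
  · exact hδ0.ne h
  · exact h left_mem_uIcc

namespace LocAC

variable {f g F φ : ℝ → ℝ}

lemma mul (hf : LocAC f) (hg : LocAC g) : LocAC (fun x => f x * g x) :=
  fun ε hε => (hf ε hε).fun_mul (hg ε hε)

lemma sq (hf : LocAC f) : LocAC (fun x => f x ^ 2) := by
  simpa only [pow_two] using hf.mul hf

lemma of_contDiff (hf : ContDiff ℝ 1 f) : LocAC f :=
  fun _ _ => hf.contDiffOn.absolutelyContinuousOnInterval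

lemma of_ac (hf : AbsolutelyContinuousOnInterval f 0 1) : LocAC f := fun ε hε =>
  hf.mono (by rw [uIcc_of_le hε.2.le, uIcc_of_le zero_le_one]; exact Icc_subset_Icc_left hε.1.le)

lemma ae_hasDerivAt (hf : LocAC f) : ∀ᵐ x ∂vol01, HasDerivAt f (deriv f x) x := by
  filter_upwards [ae_differentiableAt_of_ac hf] with x hx using hx.hasDerivAt

lemma integral_eq_sub (hF : LocAC F) (hφ : deriv F =ᵐ[vol01] φ) {x : ℝ}
    (hx : x ∈ Ioo (0 : ℝ) 1) : ∫ y in x..1, φ y = F 1 - F x := by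
  rw [← (hF x hx).integral_deriv_eq_sub, intervalIntegral.integral_of_le hx.2.le,
    intervalIntegral.integral_of_le hx.2.le, integral_Ioc_eq_integral_Ioo,
    integral_Ioc_eq_integral_Ioo]
  exact integral_congr_ae (ae_restrict_of_ae_restrict_of_subset (Ioo_subset_Ioo_left hx.1.le)
    hφ.symm)

lemma tendsto_sub_integral (hF : LocAC F) (hφ : deriv F =ᵐ[vol01] φ) (hint : Integrable φ vol01) :
    Tendsto F (𝓝[>] 0) (𝓝 (F 1 - ∫ y, φ y ∂vol01)) := by
  refine (tendsto_const_nhds.sub (tendsto_intervalIntegral_left one_pos hint)).congr' ?_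
  filter_upwards [Ioo_mem_nhdsGT zero_lt_one] with x hx
  rw [hF.integral_eq_sub hφ hx, sub_sub_cancel]

lemma integral_eq_of_tendsto (hF : LocAC F) (hφ : deriv F =ᵐ[vol01] φ)
    (hint : Integrable φ vol01) (h0 : Tendsto F (𝓝[>] 0) (𝓝 0)) : ∫ y, φ y ∂vol01 = F 1 :=
  (sub_eq_zero.1 (tendsto_nhds_unique (hF.tendsto_sub_integral hφ hint) h0)).symm

lemma tendsto_zero (hF : LocAC F) (hφ : deriv F =ᵐ[vol01] φ) (hint : Integrable φ vol01)
    (hdiv : Integrable (fun x => F x / x) vol01) : Tendsto F (𝓝[>] 0) (𝓝 0) := by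
  have h := hF.tendsto_sub_integral hφ hint
  rwa [eq_zero_of_tendsto_of_integrable_div one_pos h hdiv] at h

lemma integral_eq (hF : LocAC F) (hφ : deriv F =ᵐ[vol01] φ)
    (hint : Integrable φ vol01) (hdiv : Integrable (fun x => F x / x) vol01) :
    ∫ y, φ y ∂vol01 = F 1 :=
  hF.integral_eq_of_tendsto hφ hint (hF.tendsto_zero hφ hint hdiv)

end LocAC

/-! ### The space `V¹_a(0,1)` -/

section Weight

variable {a : ℝ → ℝ}

lemma mul_inv_sqrt_le (ha : IsDegenerateCoeff a) {x : ℝ} (hx : x ∈ Ioo (0 : ℝ) 1) :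
    |x * (√(a x))⁻¹| ≤ (√(a 1))⁻¹ := by
  have hsqrt := Real.sqrt_le_sqrt (ha.mul_sq_le ⟨hx.1, hx.2.le⟩)
  rw [Real.sqrt_mul ha.pos_one.le, Real.sqrt_sq hx.1.le] at hsqrt
  have hpos := ha.sqrt_pos hx
  rw [abs_of_pos (mul_pos hx.1 (inv_pos.2 hpos)), ← div_eq_mul_inv, div_le_iff₀ hpos,
    inv_mul_eq_div, le_div_iff₀ (Real.sqrt_pos.2 ha.pos_one)]
  linarith

lemma memLp_top_mul_inv_sqrt (ha : IsDegenerateCoeff a) :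
    MemLp (fun x => x * (√(a x))⁻¹) ⊤ vol01 :=
  memLp_top_of_bound (aestronglyMeasurable_id.mul ha.aestronglyMeasurable_inv_sqrt) (√(a 1))⁻¹
    (ae_vol01 fun _ hx => mul_inv_sqrt_le ha hx)

/-- Multiplication by the bounded function `x / √a` on `L²(0,1)`; it maps `√a u'` to the
multiplier `x u'`. -/
noncomputable def weightMul (ha : IsDegenerateCoeff a) : L2 →L[ℝ] L2 :=
  (ContinuousLinearMap.mul ℝ ℝ).holderL vol01 ⊤ 2 2 ((memLp_top_mul_inv_sqrt ha).toLp _)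

lemma weightMul_ae_eq (ha : IsDegenerateCoeff a) {u : L2} {f : ℝ → ℝ} (hf : u =ᵐ[vol01] f) :
    weightMul ha u =ᵐ[vol01] fun x => x * (√(a x))⁻¹ * f x := by
  have hmul : weightMul ha u =ᵐ[vol01] _ := (ContinuousLinearMap.mul ℝ ℝ).coeFn_holder (r := 2)
    ((memLp_top_mul_inv_sqrt ha).toLp _) u
  filter_upwards [hmul, (memLp_top_mul_inv_sqrt ha).coeFn_toLp, hf] with x h1 h2 h3
  rw [h1, ContinuousLinearMap.mul_apply', h2, h3]

lemma norm_weightMul_le (ha : IsDegenerateCoeff a) (u : L2) :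
    ‖weightMul ha u‖ ≤ (√(a 1))⁻¹ * ‖u‖ := by
  refine Lp.norm_le_mul_norm_of_ae_le_mul ?_
  filter_upwards [weightMul_ae_eq ha (EventuallyEq.refl _ u),
    ae_vol01 fun x hx => mul_inv_sqrt_le ha hx] with x hx hle
  rw [hx, norm_mul]
  gcongr
  exact hle

end Weight

namespace IsV1

variable {a f : ℝ → ℝ}

lemma weight_mul_deriv_eq (ha : IsDegenerateCoeff a) :
    (fun x => x * (√(a x))⁻¹ * (√(a x) * deriv f x)) =ᵐ[vol01] fun x => x * deriv f x :=
  ae_vol01 fun x hx => by have := (ha.sqrt_pos hx).ne'; field_simp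

lemma memLp_mul_deriv (ha : IsDegenerateCoeff a) (hf : IsV1 a f) :
    MemLp (fun x => x * deriv f x) 2 vol01 :=
  (memLp_congr_ae (weight_mul_deriv_eq ha)).1
    (memLp_of_ae_eq (weightMul_ae_eq ha hf.memLp_deriv.coeFn_toLp))

lemma integrable_mul_deriv_mul (ha : IsDegenerateCoeff a) (hf : IsV1 a f) :
    Integrable (fun x => x * deriv f x * f x) vol01 :=
  (hf.memLp_mul_deriv ha).integrable_mul hf.memLp

lemma deriv_mul_sq (hf : IsV1 a f) :
    deriv (fun x => x * f x ^ 2) =ᵐ[vol01] fun x => f x ^ 2 + 2 * (x * deriv f x * f x) := by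
  filter_upwards [LocAC.ae_hasDerivAt hf.ac] with x hx
  rw [((hasDerivAt_id' x).fun_mul (hx.fun_pow 2)).deriv]
  simp only [Nat.cast_ofNat, Nat.add_one_sub_one, pow_one]
  ring

lemma locAC_mul_sq (hf : IsV1 a f) : LocAC (fun x => x * f x ^ 2) :=
  (LocAC.of_contDiff contDiff_fun_id).mul (LocAC.sq hf.ac)

lemma integrable_mul_sq_div (hf : IsV1 a f) : Integrable (fun x => x * f x ^ 2 / x) vol01 :=
  hf.memLp.integrable_sq.congr (ae_vol01 fun _ hx => (mul_div_cancel_left₀ _ hx.1.ne').symm)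

lemma integrable_sq_add (ha : IsDegenerateCoeff a) (hf : IsV1 a f) :
    Integrable (fun x => f x ^ 2 + 2 * (x * deriv f x * f x)) vol01 :=
  hf.memLp.integrable_sq.add ((hf.integrable_mul_deriv_mul ha).const_mul 2)

lemma tendsto_mul_sq (ha : IsDegenerateCoeff a) (hf : IsV1 a f) :
    Tendsto (fun x => x * f x ^ 2) (𝓝[>] 0) (𝓝 0) :=
  hf.locAC_mul_sq.tendsto_zero hf.deriv_mul_sq (hf.integrable_sq_add ha) hf.integrable_mul_sq_div

lemma integral_mul_deriv_mul (ha : IsDegenerateCoeff a) (hf : IsV1 a f) (h1 : f 1 = 0) :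
    2 * ∫ x, x * deriv f x * f x ∂vol01 = -∫ x, f x ^ 2 ∂vol01 := by
  have h := hf.locAC_mul_sq.integral_eq hf.deriv_mul_sq (hf.integrable_sq_add ha)
    hf.integrable_mul_sq_div
  rw [integral_add hf.memLp.integrable_sq ((hf.integrable_mul_deriv_mul ha).const_mul 2),
    integral_const_mul, h1] at h
  linarith

end IsV1

/-! ### Primitives of `h / √a` -/

section Prim

variable {a : ℝ → ℝ} {x : ℝ}

lemma ae_vol01_of_forall_uIcc {p : ℝ → Prop}
    (h : ∀ ε ∈ Ioo (0 : ℝ) 1, ∀ᵐ x, x ∈ uIcc ε 1 → p x) : ∀ᵐ x ∂vol01, p x := by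
  have hmem : ∀ n : ℕ, 1 / ((n : ℝ) + 2) ∈ Ioo (0 : ℝ) 1 := fun n => by
    refine ⟨by positivity, (div_lt_one (by positivity)).2 ?_⟩
    linarith [n.cast_nonneg (α := ℝ)]
  filter_upwards [ae_restrict_of_ae (ae_all_iff.2 fun n => h _ (hmem n)),
    ae_restrict_mem measurableSet_Ioo] with x hx hx01
  obtain ⟨n, hn⟩ := exists_nat_one_div_lt hx01.1
  have hle : 1 / ((n : ℝ) + 2) ≤ 1 / ((n : ℝ) + 1) :=
    one_div_le_one_div_of_le (by positivity) (by linarith)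
  exact hx n (mem_uIcc_of_le (hle.trans hn.le) hx01.2.le)

lemma memLp_restrict_Ioc (h : L2) (hx : x ∈ Ioo (0 : ℝ) 1) :
    MemLp h 2 (volume.restrict (Ioc x 1)) := by
  rw [← restrict_Ioo_eq_restrict_Ioc]
  exact (Lp.memLp h).mono_measure (Measure.restrict_mono_set _ (Ioo_subset_Ioo_left hx.1.le))

lemma intervalIntegral_sq_le (h : L2) (hx : x ∈ Ioo (0 : ℝ) 1) :
    ∫ y in x..1, h y ^ 2 ≤ ‖h‖ ^ 2 := by
  rw [intervalIntegral.integral_of_le hx.2.le, integral_Ioc_eq_integral_Ioo,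
    norm_sq_eq_integral (EventuallyEq.refl _ h)]
  exact setIntegral_mono_set (Lp.memLp h).integrable_sq (ae_of_all _ fun _ => sq_nonneg _)
    (Ioo_subset_Ioo_left hx.1.le).eventuallyLE

lemma memLp_inv_sqrt_Ioc (ha : IsDegenerateCoeff a) (hx : x ∈ Ioo (0 : ℝ) 1) :
    MemLp (fun y => (√(a y))⁻¹) 2 (volume.restrict (Ioc x 1)) := by
  have hcont : ContinuousOn (fun y => (√(a y))⁻¹) (Icc x 1) :=
    ha.continuousOn_inv_sqrt.mono fun y hy => ⟨hx.1.trans_le hy.1, hy.2⟩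
  obtain ⟨C, hC⟩ := isCompact_Icc.exists_bound_of_continuousOn hcont
  exact MemLp.of_bound
    ((hcont.mono Ioc_subset_Icc_self).aestronglyMeasurable measurableSet_Ioc) C
    (ae_restrict_of_forall_mem measurableSet_Ioc fun y hy => hC y (Ioc_subset_Icc_self hy))

/-- The primitive of `h / √a` that vanishes at `1`: it recovers `u ∈ H¹_a(0,1)` from
`h = √a u'`. -/
noncomputable def prim (a : ℝ → ℝ) (h : L2) (x : ℝ) : ℝ := ∫ y in (1 : ℝ)..x, (√(a y))⁻¹ * h y

lemma intervalIntegrable_inv_sqrt_mul (ha : IsDegenerateCoeff a) (h : L2)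
    (hx : x ∈ Ioo (0 : ℝ) 1) :
    IntervalIntegrable (fun y => (√(a y))⁻¹ * h y) volume x 1 :=
  (intervalIntegrable_iff_integrableOn_Ioc_of_le hx.2.le).2
    ((memLp_inv_sqrt_Ioc ha hx).integrable_mul (memLp_restrict_Ioc h hx))

lemma locAC_prim (ha : IsDegenerateCoeff a) (h : L2) : LocAC (prim a h) := fun _ hε =>
  (intervalIntegrable_inv_sqrt_mul ha h hε).absolutelyContinuousOnInterval_intervalIntegral
    right_mem_uIcc

lemma sqrt_mul_deriv_prim (ha : IsDegenerateCoeff a) (h : L2) :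
    (fun x => √(a x) * deriv (prim a h) x) =ᵐ[vol01] h := by
  have hderiv : ∀ᵐ x ∂vol01, HasDerivAt (prim a h) ((√(a x))⁻¹ * h x) x := by
    refine ae_vol01_of_forall_uIcc fun ε hε => ?_
    filter_upwards [(intervalIntegrable_inv_sqrt_mul ha h hε).ae_hasDerivAt_integral] with x hx hxε
    exact hx hxε 1 right_mem_uIcc
  filter_upwards [hderiv, ae_restrict_mem measurableSet_Ioo] with x hx hx01
  rw [hx.deriv, mul_inv_cancel_left₀ (ha.sqrt_pos hx01).ne']

lemma sq_prim_le (ha : IsDegenerateCoeff a) (h : L2) (hx : x ∈ Ioo (0 : ℝ) 1) :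
    prim a h x ^ 2 ≤ (∫ y in x..1, (√(a y))⁻¹ ^ 2) * ‖h‖ ^ 2 := by
  rw [prim, intervalIntegral.integral_symm, neg_sq]
  refine (sq_intervalIntegral_mul_le hx.2.le (memLp_inv_sqrt_Ioc ha hx)
    (memLp_restrict_Ioc h hx)).trans ?_
  gcongr
  · exact intervalIntegral.integral_nonneg hx.2.le fun _ _ => sq_nonneg _
  · exact intervalIntegral_sq_le h hx

lemma lintegral_lintegral_Ioo {φ : ℝ → ENNReal} (hφ : AEMeasurable φ vol01) :
    ∫⁻ x in Ioo 0 1, ∫⁻ y in Ioo x 1, φ y = ∫⁻ y in Ioo 0 1, φ y * ENNReal.ofReal y := by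
  have hmeas : AEMeasurable (Function.uncurry fun x y : ℝ => (Ioi x).indicator φ y)
      (vol01.prod vol01) := by
    have hset : MeasurableSet {p : ℝ × ℝ | p.1 < p.2} :=
      measurableSet_lt measurable_fst measurable_snd
    exact hφ.comp_snd.indicator hset
  calc ∫⁻ x in Ioo 0 1, ∫⁻ y in Ioo x 1, φ y
      = ∫⁻ x in Ioo 0 1, ∫⁻ y in Ioo 0 1, (Ioi x).indicator φ y := by
        refine setLIntegral_congr_fun measurableSet_Ioo fun x hx => ?_
        rw [lintegral_indicator measurableSet_Ioi, Measure.restrict_restrict measurableSet_Ioi,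
          Ioi_inter_Ioo, max_eq_left hx.1.le]
    _ = ∫⁻ y in Ioo 0 1, ∫⁻ x in Ioo 0 1, (Ioi x).indicator φ y := lintegral_lintegral_swap hmeas
    _ = ∫⁻ y in Ioo 0 1, ∫⁻ x in Ioo 0 1, (Iio y).indicator (fun _ => φ y) x := by
        simp only [indicator, mem_Ioi, mem_Iio]
    _ = ∫⁻ y in Ioo 0 1, φ y * ENNReal.ofReal y := by
        refine setLIntegral_congr_fun measurableSet_Ioo fun y hy => ?_
        rw [lintegral_indicator measurableSet_Iio, Measure.restrict_restrict measurableSet_Iio,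
          Iio_inter_Ioo, min_eq_left hy.2.le, setLIntegral_const, Real.volume_Ioo, sub_zero]

lemma inv_sqrt_sq_le (ha : IsDegenerateCoeff a) (hx : x ∈ Ioo (0 : ℝ) 1) :
    (√(a x))⁻¹ ^ 2 ≤ (a 1)⁻¹ * x ^ (-mu a) := by
  have hpos := ha.pos x ⟨hx.1, hx.2.le⟩
  rw [inv_pow, Real.sq_sqrt hpos.le, Real.rpow_neg hx.1.le, ← mul_inv]
  exact inv_anti₀ (mul_pos ha.pos_one (Real.rpow_pos_of_pos hx.1 _))
    (ha.mul_rpow_le ⟨hx.1, hx.2.le⟩)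

lemma lintegral_inv_sqrt_sq_mul_le (ha : IsDegenerateCoeff a) :
    ∫⁻ x in Ioo 0 1, ENNReal.ofReal ((√(a x))⁻¹ ^ 2) * ENNReal.ofReal x ≤
      ENNReal.ofReal (1 / a 1 * (1 / (2 - mu a))) := by
  have h2 := ha.two_sub_mu_pos
  have hint : IntervalIntegrable (fun x : ℝ => x ^ (1 - mu a)) volume 0 1 :=
    intervalIntegral.intervalIntegrable_rpow' (by linarith)
  have hval : ∫ x in Ioo 0 1, (a 1)⁻¹ * x ^ (1 - mu a) = 1 / a 1 * (1 / (2 - mu a)) := by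
    rw [integral_const_mul, ← integral_Ioc_eq_integral_Ioo,
      ← intervalIntegral.integral_of_le zero_le_one, integral_rpow (Or.inl (by linarith)),
      Real.one_rpow, Real.zero_rpow (by linarith)]
    ring
  rw [← hval, ofReal_integral_eq_lintegral_ofReal]
  · refine setLIntegral_mono' measurableSet_Ioo fun x hx => ?_
    rw [← ENNReal.ofReal_mul (by positivity)]
    refine ENNReal.ofReal_le_ofReal ?_
    rw [← neg_add_eq_sub, Real.rpow_add_one hx.1.ne', ← mul_assoc]
    exact mul_le_mul_of_nonneg_right (inv_sqrt_sq_le ha hx) hx.1.le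
  · exact ((intervalIntegrable_iff_integrableOn_Ioo_of_le zero_le_one).1 hint).const_mul _
  · have := ha.pos_one
    exact ae_vol01 fun x hx => mul_nonneg (by positivity) (Real.rpow_nonneg hx.1.le _)

lemma lintegral_sq_prim_le (ha : IsDegenerateCoeff a) (h : L2) :
    ∫⁻ x in Ioo 0 1, ENNReal.ofReal (prim a h x ^ 2) ≤
      ENNReal.ofReal (1 / a 1 * (1 / (2 - mu a)) * ‖h‖ ^ 2) := by
  have hle : ∀ x ∈ Ioo (0 : ℝ) 1, ENNReal.ofReal (prim a h x ^ 2) ≤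
      (∫⁻ y in Ioo x 1, ENNReal.ofReal ((√(a y))⁻¹ ^ 2)) * ENNReal.ofReal (‖h‖ ^ 2) := by
    intro x hx
    have hint := (memLp_inv_sqrt_Ioc ha hx).integrable_sq
    rw [← restrict_Ioo_eq_restrict_Ioc] at hint
    rw [← ofReal_integral_eq_lintegral_ofReal hint (ae_of_all _ fun _ => sq_nonneg _),
      ← ENNReal.ofReal_mul' (sq_nonneg _), ← integral_Ioc_eq_integral_Ioo,
      ← intervalIntegral.integral_of_le hx.2.le]
    exact ENNReal.ofReal_le_ofReal (sq_prim_le ha h hx)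
  have hmeas : AEMeasurable (fun y => ENNReal.ofReal ((√(a y))⁻¹ ^ 2)) vol01 :=
    (ha.aestronglyMeasurable_inv_sqrt.aemeasurable.pow_const 2).ennreal_ofReal
  calc ∫⁻ x in Ioo 0 1, ENNReal.ofReal (prim a h x ^ 2)
      ≤ ∫⁻ x in Ioo 0 1, (∫⁻ y in Ioo x 1, ENNReal.ofReal ((√(a y))⁻¹ ^ 2)) *
          ENNReal.ofReal (‖h‖ ^ 2) := setLIntegral_mono' measurableSet_Ioo hle
    _ = (∫⁻ y in Ioo 0 1, ENNReal.ofReal ((√(a y))⁻¹ ^ 2) * ENNReal.ofReal y) *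
          ENNReal.ofReal (‖h‖ ^ 2) := by
        rw [lintegral_mul_const' _ _ ENNReal.ofReal_ne_top, lintegral_lintegral_Ioo hmeas]
    _ ≤ ENNReal.ofReal (1 / a 1 * (1 / (2 - mu a)) * ‖h‖ ^ 2) := by
        rw [ENNReal.ofReal_mul' (sq_nonneg _)]
        gcongr
        exact lintegral_inv_sqrt_sq_mul_le ha

lemma aestronglyMeasurable_prim (ha : IsDegenerateCoeff a) (h : L2) :
    AEStronglyMeasurable (prim a h) vol01 := by
  refine ContinuousOn.aestronglyMeasurable (fun x hx => ?_) measurableSet_Ioo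
  have hhalf : x / 2 ∈ Ioo (0 : ℝ) 1 := ⟨half_pos hx.1, (half_lt_self hx.1).trans hx.2⟩
  have hcont := (locAC_prim ha h _ hhalf).continuousOn
  rw [uIcc_of_le hhalf.2.le] at hcont
  exact (hcont.continuousAt (Icc_mem_nhds (half_lt_self hx.1) hx.2)).continuousWithinAt

lemma memLp_prim (ha : IsDegenerateCoeff a) (h : L2) : MemLp (prim a h) 2 vol01 := by
  refine (memLp_two_iff_integrable_sq (aestronglyMeasurable_prim ha h)).2
    ⟨(aestronglyMeasurable_prim ha h).pow 2, ?_⟩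
  rw [hasFiniteIntegral_iff_ofReal (ae_of_all _ fun _ => sq_nonneg _)]
  exact (lintegral_sq_prim_le ha h).trans_lt ENNReal.ofReal_lt_top

lemma integral_sq_prim_le (ha : IsDegenerateCoeff a) (h : L2) :
    ∫ x, prim a h x ^ 2 ∂vol01 ≤ 1 / a 1 * (1 / (2 - mu a)) * ‖h‖ ^ 2 := by
  have h1 := ha.pos_one
  have h2 := ha.two_sub_mu_pos
  rw [← ENNReal.ofReal_le_ofReal_iff (by positivity), ofReal_integral_eq_lintegral_ofReal
    (memLp_prim ha h).integrable_sq (ae_of_all _ fun _ => sq_nonneg _)]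
  exact lintegral_sq_prim_le ha h

lemma isV1_prim (ha : IsDegenerateCoeff a) (h : L2) : IsV1 a (prim a h) where
  memLp := memLp_prim ha h
  ac := locAC_prim ha h
  memLp_deriv := (memLp_congr_ae (sqrt_mul_deriv_prim ha h)).2 (Lp.memLp h)

lemma memLp_inv_sqrt (ha : IsDegenerateCoeff a) (hmu : mu a < 1) :
    MemLp (fun x => (√(a x))⁻¹) 2 vol01 := by
  have hrpow : IntegrableOn (fun x : ℝ => x ^ (-mu a)) (Ioo 0 1) := by
    rw [← intervalIntegrable_iff_integrableOn_Ioo_of_le zero_le_one]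
    exact intervalIntegral.intervalIntegrable_rpow' (by linarith)
  have hmeas := ha.aestronglyMeasurable_inv_sqrt
  refine (memLp_two_iff_integrable_sq hmeas).2
    ((hrpow.const_mul (a 1)⁻¹).mono' (hmeas.pow 2) (ae_vol01 fun x hx => ?_))
  rw [Real.norm_of_nonneg (sq_nonneg _)]
  exact inv_sqrt_sq_le ha hx

lemma tendsto_prim (ha : IsDegenerateCoeff a) (hmu : mu a < 1) (h : L2) :
    Tendsto (prim a h) (𝓝[>] 0) (𝓝 (-inner ℝ ((memLp_inv_sqrt ha hmu).toLp _) h)) := by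
  rw [inner_eq_integral (memLp_inv_sqrt ha hmu).coeFn_toLp (EventuallyEq.refl _ h)]
  refine (tendsto_intervalIntegral_left one_pos
    ((memLp_inv_sqrt ha hmu).integrable_mul (Lp.memLp h))).neg.congr fun x => ?_
  exact (intervalIntegral.integral_symm _ _).symm

end Prim

/-! ### The space `H¹_a(0,1)` -/

section H1Space

variable {a : ℝ → ℝ} {ha : IsDegenerateCoeff a}

lemma poincareConst_nonneg (ha : IsDegenerateCoeff a) : 0 ≤ poincareConst a := by
  have hone := ha.pos_one
  have htwo := ha.two_sub_mu_pos
  rw [poincareConst]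
  positivity

namespace H1

lemma inner_eq_grad (u v : H1 ha) : inner ℝ u v = inner ℝ u.grad v.grad := rfl

lemma norm_eq_grad (u : H1 ha) : ‖u‖ = ‖u.grad‖ := rfl

lemma weightMul_grad_ae_eq (u : H1 ha) :
    weightMul ha u.grad =ᵐ[vol01] fun x => x * deriv u.rep x :=
  (weightMul_ae_eq ha u.grad_ae_eq).trans (IsV1.weight_mul_deriv_eq ha)

lemma two_inner_weightMul_grad (u : H1 ha) :
    2 * inner ℝ (weightMul ha u.grad) u.toL2 = -‖u.toL2‖ ^ 2 := by
  rw [inner_eq_integral u.weightMul_grad_ae_eq u.toL2_ae_eq, norm_sq_eq_integral u.toL2_ae_eq]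
  exact u.isH1_rep.toIsV1.integral_mul_deriv_mul ha u.isH1_rep.at_one

lemma rep_eq_prim (u : H1 ha) {x : ℝ} (hx : x ∈ Ioo (0 : ℝ) 1) : u.rep x = prim a u.grad x := by
  have hderiv : deriv u.rep =ᵐ[vol01] fun x => (√(a x))⁻¹ * u.grad x := by
    filter_upwards [u.grad_ae_eq, ae_restrict_mem measurableSet_Ioo] with x hgrad hx
    rw [hgrad, inv_mul_cancel_left₀ (ha.sqrt_pos hx).ne']
  rw [prim, intervalIntegral.integral_symm, LocAC.integral_eq_sub u.isH1_rep.ac hderiv hx,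
    u.isH1_rep.at_one, zero_sub, neg_neg]

lemma norm_toL2_sq_le_hardy (u : H1 ha) : ‖u.toL2‖ ^ 2 ≤ 1 / a 1 * 4 * ‖u‖ ^ 2 := by
  have hle : ‖u.toL2‖ ≤ 2 * ‖weightMul ha u.grad‖ := by
    by_contra! hlt
    have hpos : 0 < ‖u.toL2‖ := lt_of_le_of_lt (by positivity) hlt
    have hCS := abs_real_inner_le_norm (weightMul ha u.grad) u.toL2
    nlinarith [u.two_inner_weightMul_grad, neg_abs_le (inner ℝ (weightMul ha u.grad) u.toL2)]
  calc ‖u.toL2‖ ^ 2 ≤ (2 * ((√(a 1))⁻¹ * ‖u.grad‖)) ^ 2 := by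
        gcongr
        exact hle.trans (by gcongr; exact norm_weightMul_le ha u.grad)
    _ = 1 / a 1 * 4 * ‖u‖ ^ 2 := by
        rw [mul_pow, mul_pow, inv_pow, Real.sq_sqrt ha.pos_one.le, norm_eq_grad]
        ring

lemma norm_toL2_sq_le (u : H1 ha) : ‖u.toL2‖ ^ 2 ≤ poincareConst a * ‖u‖ ^ 2 := by
  have hprim : ‖u.toL2‖ ^ 2 ≤ 1 / a 1 * (1 / (2 - mu a)) * ‖u‖ ^ 2 := by
    rw [norm_sq_eq_integral (u.toL2_ae_eq.trans (ae_vol01 fun _ hx => u.rep_eq_prim hx))]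
    exact integral_sq_prim_le ha u.grad
  rcases min_choice 4 (1 / (2 - mu a)) with hmin | hmin
  · rw [poincareConst, hmin]
    exact u.norm_toL2_sq_le_hardy
  · rw [poincareConst, hmin]
    exact hprim

lemma norm_toL2_le (u : H1 ha) : ‖u.toL2‖ ≤ √(poincareConst a) * ‖u‖ := by
  refine abs_le_of_sq_le_sq' ?_ (by positivity) |>.2
  rw [mul_pow, Real.sq_sqrt (poincareConst_nonneg ha)]
  exact u.norm_toL2_sq_le

/-- The inclusion `H¹_a(0,1) → L²(0,1)` as a bounded operator. -/
noncomputable def toL2L (ha : IsDegenerateCoeff a) : H1 ha →L[ℝ] L2 :=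
  LinearMap.mkContinuous H1.toL2 (√(poincareConst a)) norm_toL2_le

@[simp] lemma toL2L_apply (u : H1 ha) : toL2L ha u = u.toL2 := rfl

/-- The linear isometry `u ↦ √a u'` of `H¹_a(0,1)` into `L²(0,1)`. -/
noncomputable def gradL (ha : IsDegenerateCoeff a) : H1 ha →ₗᵢ[ℝ] L2 where
  toLinearMap := H1.grad
  norm_map' _ := rfl

@[simp] lemma gradL_apply (u : H1 ha) : gradL ha u = u.grad := rfl

lemma mem_range_gradL_iff (h : L2) : h ∈ range (gradL ha) ↔
    ∀ hmu : mu a < 1, inner ℝ ((memLp_inv_sqrt ha hmu).toLp _) h = 0 := by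
  constructor
  · rintro ⟨u, rfl⟩ hmu
    have hprim : u.rep =ᶠ[𝓝[>] 0] prim a u.grad := by
      filter_upwards [Ioo_mem_nhdsGT zero_lt_one] with x hx using u.rep_eq_prim hx
    exact neg_eq_zero.1 (tendsto_nhds_unique (tendsto_prim ha hmu u.grad)
      ((u.isH1_rep.at_zero hmu).congr' hprim))
  · intro horth
    have hH1 : IsH1 a (prim a h) :=
      { isV1_prim ha h with
        at_one := intervalIntegral.integral_same
        at_zero := fun hmu => by simpa [horth hmu] using tendsto_prim ha hmu h }
    let u : H1 ha := ⟨hH1.memLp.toLp _, prim a h, hH1.memLp.coeFn_toLp, hH1⟩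
    have hu : u.toL2 =ᵐ[vol01] prim a h := hH1.memLp.coeFn_toLp
    refine ⟨u, Lp.ext ((u.grad_ae_eq.trans (ae_vol01 fun x hx => ?_)).trans
      (sqrt_mul_deriv_prim ha h))⟩
    exact congrArg (√(a x) * ·) (u.deriv_rep_eq hH1.toIsV1 hu hx)

instance : CompleteSpace (H1 ha) := by
  have hrange : range (gradL ha) =
      ⋂ hmu : mu a < 1, {h | inner ℝ ((memLp_inv_sqrt ha hmu).toLp _) h = 0} := by
    ext h
    simp only [mem_range_gradL_iff, mem_iInter, mem_ofPred_eq]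
  have hclosed : IsClosed (range (gradL ha)) := by
    rw [hrange]
    exact isClosed_iInter fun hmu => isClosed_eq (by fun_prop) continuous_const
  exact (completeSpace_iff_isComplete_range (gradL ha).isometry.isUniformInducing).2
    hclosed.isComplete

end H1

end H1Space

/-! ### The flux `a u'` -/

section Flux

variable {a : ℝ → ℝ} {ha : IsDegenerateCoeff a}

lemma memLp_sqrt (ha : IsDegenerateCoeff a) : MemLp (fun x => √(a x)) 2 vol01 := by
  obtain ⟨C, hC⟩ := isCompact_Icc.exists_bound_of_continuousOn ha.continuousOn.sqrt
  refine MemLp.of_bound ?_ C (ae_vol01 fun x hx => hC x (Ioo_subset_Icc_self hx))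
  exact (ha.continuousOn.sqrt.mono Ioo_subset_Icc_self).aestronglyMeasurable measurableSet_Ioo

lemma memLp_id : MemLp (fun x : ℝ => x) 2 vol01 := by
  refine MemLp.of_bound aestronglyMeasurable_id 1 (ae_vol01 fun x hx => ?_)
  rw [Real.norm_eq_abs, abs_of_pos hx.1]
  exact hx.2.le

/-- `g` is the absolutely continuous representative of the flux `a u'`, and `(a u')' = w`. -/
structure IsFlux (u : H1 ha) (w : L2) (g : ℝ → ℝ) : Prop where
  ac : AbsolutelyContinuousOnInterval g 0 1
  ae_eq : (fun x => a x * deriv u.rep x) =ᵐ[vol01] g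
  deriv_ae_eq : w =ᵐ[vol01] deriv g

lemma hasFluxDeriv_iff {u : H1 ha} {w : L2} : HasFluxDeriv u w ↔ ∃ g, IsFlux u w g :=
  ⟨fun ⟨g, hac, hg, hw⟩ => ⟨g, hac, hg, hw⟩, fun ⟨g, h⟩ => ⟨g, h.ac, h.ae_eq, h.deriv_ae_eq⟩⟩

namespace IsFlux

variable {u : H1 ha} {w : L2} {g : ℝ → ℝ}

lemma continuousOn (h : IsFlux u w g) : ContinuousOn g (Icc 0 1) :=
  uIcc_of_le (zero_le_one' ℝ) ▸ h.ac.continuousOn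

lemma tendsto (h : IsFlux u w g) : Tendsto g (𝓝[>] 0) (𝓝 (g 0)) :=
  (h.continuousOn 0 ⟨le_rfl, zero_le_one⟩).mono_left
    (nhdsWithin_le_iff.2 (Icc_mem_nhdsGT zero_lt_one))

lemma locAC (h : IsFlux u w g) : LocAC g := LocAC.of_ac h.ac

lemma memLp_deriv (h : IsFlux u w g) : MemLp (deriv g) 2 vol01 := memLp_of_ae_eq h.deriv_ae_eq

lemma sq_div_ae_eq (h : IsFlux u w g) :
    (fun x => g x ^ 2 / a x) =ᵐ[vol01] fun x => (√(a x) * deriv u.rep x) ^ 2 := by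
  filter_upwards [h.ae_eq, ae_restrict_mem measurableSet_Ioo] with x hg hx
  have hpos := ha.pos x ⟨hx.1, hx.2.le⟩
  rw [← hg, mul_pow (√(a x)), Real.sq_sqrt hpos.le]
  field_simp

lemma integrable_sq_div (h : IsFlux u w g) : Integrable (fun x => g x ^ 2 / a x) vol01 :=
  u.isH1_rep.memLp_deriv.integrable_sq.congr h.sq_div_ae_eq.symm

lemma eq_zero (h : IsFlux u w g) (hmu : 1 ≤ mu a) : g 0 = 0 := by
  obtain ⟨K, hK⟩ := ha.exists_le_mul hmu
  refine pow_eq_zero_iff two_ne_zero |>.1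
    (eq_zero_of_tendsto_of_integrable_div one_pos (h.tendsto.pow 2) ?_)
  have hmeas : AEStronglyMeasurable (fun x => g x ^ 2 / x) vol01 :=
    ContinuousOn.aestronglyMeasurable (((h.continuousOn.mono Ioo_subset_Icc_self).pow 2).div
      continuousOn_id fun x hx => hx.1.ne') measurableSet_Ioo
  refine (h.integrable_sq_div.const_mul K).mono' hmeas (ae_vol01 fun x hx => ?_)
  have hpos := ha.pos x ⟨hx.1, hx.2.le⟩
  rw [Real.norm_of_nonneg (div_nonneg (sq_nonneg _) hx.1.le), ← mul_div_assoc,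
    div_le_div_iff₀ hx.1 hpos]
  linarith [mul_le_mul_of_nonneg_right (hK x ⟨hx.1, hx.2.le⟩) (sq_nonneg (g x))]

lemma sq_le (h : IsFlux u w g) (hmu : 1 ≤ mu a) {x : ℝ} (hx : x ∈ Ioo (0 : ℝ) 1) :
    g x ^ 2 ≤ x * ‖w‖ ^ 2 := by
  have hac : AbsolutelyContinuousOnInterval g 0 x := h.ac.mono <| by
    rw [uIcc_of_le zero_le_one, uIcc_of_le hx.1.le]
    exact Icc_subset_Icc_right hx.2.le
  have hderiv : MemLp (deriv g) 2 (volume.restrict (Ioc 0 x)) := by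
    rw [← restrict_Ioo_eq_restrict_Ioc]
    exact h.memLp_deriv.mono_measure (Measure.restrict_mono_set _ (Ioo_subset_Ioo_right hx.2.le))
  have hg : ∫ y in (0 : ℝ)..x, 1 * deriv g y = g x := by
    simp only [one_mul]
    rw [hac.integral_deriv_eq_sub, h.eq_zero hmu, sub_zero]
  have hsq : ∫ y in (0 : ℝ)..x, deriv g y ^ 2 ≤ ‖w‖ ^ 2 := by
    rw [intervalIntegral.integral_of_le hx.1.le, integral_Ioc_eq_integral_Ioo,
      norm_sq_eq_integral h.deriv_ae_eq]
    exact setIntegral_mono_set h.memLp_deriv.integrable_sq (ae_of_all _ fun _ => sq_nonneg _)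
      (Ioo_subset_Ioo_right hx.2.le).eventuallyLE
  calc g x ^ 2 ≤ (∫ _ in (0 : ℝ)..x, (1 : ℝ) ^ 2) * ∫ y in (0 : ℝ)..x, deriv g y ^ 2 :=
        hg ▸ sq_intervalIntegral_mul_le hx.1.le (memLp_const 1) hderiv
    _ ≤ x * ‖w‖ ^ 2 := by
        rw [one_pow, intervalIntegral.integral_const, sub_zero, smul_eq_mul, mul_one]
        exact mul_le_mul_of_nonneg_left hsq hx.1.le

lemma tendsto_mul (h : IsFlux u w g) (v : H1 ha) :
    Tendsto (fun x => v.rep x * g x) (𝓝[>] 0) (𝓝 0) := by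
  rcases lt_or_ge (mu a) 1 with hmu | hmu
  · simpa only [zero_mul] using (v.isH1_rep.at_zero hmu).mul h.tendsto
  · have hbound := (v.isH1_rep.toIsV1.tendsto_mul_sq ha).const_mul (‖w‖ ^ 2)
    rw [mul_zero] at hbound
    have hsq : Tendsto (fun x => (v.rep x * g x) ^ 2) (𝓝[>] 0) (𝓝 0) := by
      refine squeeze_zero' (Eventually.of_forall fun x => sq_nonneg _) ?_ hbound
      filter_upwards [Ioo_mem_nhdsGT zero_lt_one] with x hx
      rw [mul_pow]
      linarith [mul_le_mul_of_nonneg_left (h.sq_le hmu hx) (sq_nonneg (v.rep x))]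
    refine (tendsto_zero_iff_abs_tendsto_zero _).2 ?_
    simpa only [Real.sqrt_sq_eq_abs, Real.sqrt_zero, Function.comp_def] using hsq.sqrt

/-! ### Green's formula and the normal derivative -/

lemma inner_toL2 (h : IsFlux u w g) (v : H1 ha) :
    inner ℝ v.toL2 w = -inner ℝ v.grad u.grad := by
  have hgrad : Integrable (fun x => √(a x) * deriv v.rep x * (√(a x) * deriv u.rep x)) vol01 :=
    v.isH1_rep.memLp_deriv.integrable_mul u.isH1_rep.memLp_deriv
  have hrep : Integrable (fun x => v.rep x * deriv g x) vol01 :=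
    v.isH1_rep.memLp.integrable_mul h.memLp_deriv
  have hderiv : deriv (fun x => v.rep x * g x) =ᵐ[vol01] fun x =>
      √(a x) * deriv v.rep x * (√(a x) * deriv u.rep x) + v.rep x * deriv g x := by
    filter_upwards [LocAC.ae_hasDerivAt v.isH1_rep.ac, h.locAC.ae_hasDerivAt, h.ae_eq,
      ae_restrict_mem measurableSet_Ioo] with x hv hg hflux hx
    rw [(hv.fun_mul hg).deriv, ← hflux]
    linear_combination
      (-deriv v.rep x * deriv u.rep x) * Real.mul_self_sqrt (ha.pos x ⟨hx.1, hx.2.le⟩).le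
  have hzero := (LocAC.mul v.isH1_rep.ac h.locAC).integral_eq_of_tendsto hderiv (hgrad.add hrep)
    (h.tendsto_mul v)
  rw [integral_add hgrad hrep, v.isH1_rep.at_one, zero_mul] at hzero
  rw [inner_eq_integral v.toL2_ae_eq h.deriv_ae_eq, inner_eq_integral v.grad_ae_eq u.grad_ae_eq]
  linarith

lemma rep_eq_integral (h : IsFlux u w g) {x : ℝ} (hx : x ∈ Ioc (0 : ℝ) 1) :
    u.rep x = ∫ y in (1 : ℝ)..x, g y / a y := by
  have hderiv : deriv u.rep =ᵐ[vol01] fun x => g x / a x := by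
    filter_upwards [h.ae_eq, ae_restrict_mem measurableSet_Ioo] with x hflux hx
    rw [← hflux, mul_div_cancel_left₀ _ (ha.pos x ⟨hx.1, hx.2.le⟩).ne']
  rcases hx.2.eq_or_lt with rfl | hx1
  · rw [intervalIntegral.integral_same, u.isH1_rep.at_one]
  · rw [intervalIntegral.integral_symm,
      LocAC.integral_eq_sub u.isH1_rep.ac hderiv ⟨hx.1, hx1⟩, u.isH1_rep.at_one, zero_sub, neg_neg]

lemma mul_normalDeriv (h : IsFlux u w g) : a 1 * u.normalDeriv = g 1 := by
  have h01 : (1 : ℝ) ∈ Ioc (0 : ℝ) 1 := ⟨one_pos, le_rfl⟩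
  have hcont : ContinuousOn (fun x => g x / a x) (Ioc 0 1) :=
    (h.continuousOn.mono Ioc_subset_Icc_self).div ha.continuousOn_Ioc
      fun x hx => (ha.pos x hx).ne'
  have hnhds : 𝓝[Ioc 0 1] (1 : ℝ) = 𝓝[≤] 1 := nhdsWithin_Ioc_eq_nhdsLE one_pos
  have hprim : HasDerivWithinAt (fun x => ∫ y in (1 : ℝ)..x, g y / a y) (g 1 / a 1) (Iic 1) 1 := by
    refine intervalIntegral.integral_hasDerivWithinAt_right IntervalIntegrable.refl
      (t := Iic 1) ?_ ?_
    · exact hnhds ▸ hcont.stronglyMeasurableAtFilter_nhdsWithin measurableSet_Ioc 1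
    · exact (hcont 1 h01).mono_left hnhds.ge
  have hrep : HasDerivWithinAt u.rep (g 1 / a 1) (Ioc 0 1) 1 :=
    (hprim.mono Ioc_subset_Iic_self).congr (fun x hx => h.rep_eq_integral hx)
      (h.rep_eq_integral h01)
  rw [H1.normalDeriv, hrep.derivWithin (uniqueDiffOn_Ioc 0 1 1 h01),
    mul_div_cancel₀ _ ha.pos_one.ne']

lemma mul_normalDeriv_eq_inner (h : IsFlux u w g) : a 1 * u.normalDeriv =
    inner ℝ ((memLp_sqrt ha).toLp _) u.grad + inner ℝ (memLp_id.toLp _) w := by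
  have hgrad : Integrable (fun x => √(a x) * (√(a x) * deriv u.rep x)) vol01 :=
    (memLp_sqrt ha).integrable_mul u.isH1_rep.memLp_deriv
  have hid : Integrable (fun x => x * deriv g x) vol01 := memLp_id.integrable_mul h.memLp_deriv
  have hderiv : deriv (fun x => x * g x) =ᵐ[vol01] fun x =>
      √(a x) * (√(a x) * deriv u.rep x) + x * deriv g x := by
    filter_upwards [h.locAC.ae_hasDerivAt, h.ae_eq, ae_restrict_mem measurableSet_Ioo]
      with x hg hflux hx
    rw [((hasDerivAt_id' x).fun_mul hg).deriv, ← hflux]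
    linear_combination (-deriv u.rep x) * Real.mul_self_sqrt (ha.pos x ⟨hx.1, hx.2.le⟩).le
  have hzero : Tendsto (fun x => x * g x) (𝓝[>] 0) (𝓝 0) := by
    have hid : Tendsto (fun x : ℝ => x) (𝓝[>] 0) (𝓝 0) := tendsto_id.mono_left nhdsWithin_le_nhds
    simpa only [zero_mul] using hid.mul h.tendsto
  have hsum := ((LocAC.of_contDiff contDiff_fun_id).mul h.locAC).integral_eq_of_tendsto hderiv
    (hgrad.add hid) hzero
  rw [h.mul_normalDeriv, inner_eq_integral (memLp_sqrt ha).coeFn_toLp u.grad_ae_eq,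
    inner_eq_integral memLp_id.coeFn_toLp h.deriv_ae_eq, ← integral_add hgrad hid, hsum, one_mul]

end IsFlux

/-! ### The multiplier `x u'` -/

lemma abs_mul_deriv_div_le (ha : IsDegenerateCoeff a) {x : ℝ} (hx : x ∈ Ioo (0 : ℝ) 1) :
    |x * deriv a x / a x| ≤ mu a := by
  have hpos := ha.pos x ⟨hx.1, hx.2.le⟩
  rw [abs_div, abs_mul, abs_of_pos hx.1, abs_of_pos hpos, div_le_iff₀ hpos]
  exact ha.mul_abs_deriv_le hx

lemma integrable_one_sub_mul_sq (ha : IsDegenerateCoeff a) {f : ℝ → ℝ} (hf : MemLp f 2 vol01) :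
    Integrable (fun x => (1 - x * deriv a x / a x) * f x ^ 2) vol01 := by
  have hmeas : AEStronglyMeasurable (fun x => x * deriv a x / a x) vol01 :=
    ((measurable_id.mul (measurable_deriv a)).aemeasurable.div
      ((ha.continuousOn.mono Ioo_subset_Icc_self).aemeasurable
        measurableSet_Ioo)).aestronglyMeasurable
  refine hf.integrable_sq.bdd_mul (c := 1 + mu a) (aestronglyMeasurable_const.sub hmeas)
    (ae_vol01 fun x hx => (norm_sub_le _ _).trans ?_)
  rw [norm_one]
  exact add_le_add le_rfl (abs_mul_deriv_div_le ha hx)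

namespace IsFlux

variable {u : H1 ha} {w : L2} {g : ℝ → ℝ}

lemma deriv_multiplier (h : IsFlux u w g) :
    deriv (fun x => x * (a x)⁻¹ * g x ^ 2) =ᵐ[vol01] fun x =>
      (1 - x * deriv a x / a x) * (√(a x) * deriv u.rep x) ^ 2
        + 2 * (x * deriv u.rep x * deriv g x) := by
  filter_upwards [h.locAC.ae_hasDerivAt, h.ae_eq, ae_restrict_mem measurableSet_Ioo]
    with x hg hflux hx
  have hpos := ha.pos x ⟨hx.1, hx.2.le⟩
  have hinv := (ha.hasDerivAt hx).fun_inv hpos.ne'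
  rw [(((hasDerivAt_id' x).fun_mul hinv).fun_mul (hg.fun_pow 2)).deriv, ← hflux,
    mul_pow (√(a x)), Real.sq_sqrt hpos.le]
  simp only [Nat.cast_ofNat, Nat.add_one_sub_one, pow_one]
  field_simp
  ring

lemma multiplier_identity (h : IsFlux u w g) :
    a 1 * u.normalDeriv ^ 2 - 2 * inner ℝ (weightMul ha u.grad) w =
      ∫ x, (1 - x * deriv a x / a x) * (√(a x) * deriv u.rep x) ^ 2 ∂vol01 := by
  have hgrad := integrable_one_sub_mul_sq ha u.isH1_rep.memLp_deriv
  have hmul : Integrable (fun x => 2 * (x * deriv u.rep x * deriv g x)) vol01 :=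
    ((u.isH1_rep.toIsV1.memLp_mul_deriv ha).integrable_mul h.memLp_deriv).const_mul 2
  have hac : LocAC (fun x => x * (a x)⁻¹ * g x ^ 2) :=
    ((LocAC.of_contDiff contDiff_fun_id).mul fun ε hε => ha.ac_inv hε).mul h.locAC.sq
  have hdiv : Integrable (fun x => x * (a x)⁻¹ * g x ^ 2 / x) vol01 :=
    h.integrable_sq_div.congr (ae_vol01 fun x hx => by have := hx.1.ne'; field_simp)
  have hsum := hac.integral_eq h.deriv_multiplier (hgrad.add hmul) hdiv
  rw [integral_add hgrad hmul, integral_const_mul, ← h.mul_normalDeriv,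
    ← inner_eq_integral u.weightMul_grad_ae_eq h.deriv_ae_eq] at hsum
  have hone : 1 * (a 1)⁻¹ * (a 1 * u.normalDeriv) ^ 2 = a 1 * u.normalDeriv ^ 2 := by
    have := ha.pos_one.ne'
    field_simp
  rw [← hone, ← hsum, add_sub_cancel_right]

lemma one_sub_mu_mul_le_multiplier (h : IsFlux u w g) :
    (1 - mu a) * ‖u‖ ^ 2 ≤ a 1 * u.normalDeriv ^ 2 - 2 * inner ℝ (weightMul ha u.grad) w := by
  have hgrad := u.isH1_rep.memLp_deriv
  rw [h.multiplier_identity, H1.norm_eq_grad, norm_sq_eq_integral u.grad_ae_eq,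
    ← integral_const_mul]
  refine integral_mono_ae (hgrad.integrable_sq.const_mul _) (integrable_one_sub_mul_sq ha hgrad)
    (ae_vol01 fun x hx => mul_le_mul_of_nonneg_right ?_ (sq_nonneg _))
  exact sub_le_sub_left (abs_le.1 (abs_mul_deriv_div_le ha hx)).2 1

lemma multiplier_le (h : IsFlux u w g) :
    a 1 * u.normalDeriv ^ 2 - 2 * inner ℝ (weightMul ha u.grad) w ≤ 3 * ‖u‖ ^ 2 := by
  have hgrad := u.isH1_rep.memLp_deriv
  rw [h.multiplier_identity, H1.norm_eq_grad, norm_sq_eq_integral u.grad_ae_eq,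
    ← integral_const_mul]
  refine integral_mono_ae (integrable_one_sub_mul_sq ha hgrad) (hgrad.integrable_sq.const_mul _)
    (ae_vol01 fun x hx => mul_le_mul_of_nonneg_right ?_ (sq_nonneg _))
  linarith [(abs_le.1 (abs_mul_deriv_div_le ha hx)).1, ha.mu_lt_two]

end IsFlux

end Flux

/-! ### Contraction semigroups -/

section OneSidedDeriv

variable {E : Type*} [NormedAddCommGroup E] [NormedSpace ℝ E]

lemma hasDerivWithinAt_Ioi_iff_tendsto_inv_smul {f : ℝ → E} {f' : E} {t : ℝ} :
    HasDerivWithinAt f f' (Ioi t) t ↔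
      Tendsto (fun r => r⁻¹ • (f (t + r) - f t)) (𝓝[>] 0) (𝓝 f') := by
  have hmap : map (t + ·) (𝓝[>] (0 : ℝ)) = 𝓝[>] t := by
    simpa only [Homeomorph.coe_addLeft, image_const_add_Ioi, add_zero]
      using (Homeomorph.addLeft t).isEmbedding.map_nhdsWithin_eq (Ioi 0) 0
  rw [hasDerivWithinAt_iff_tendsto_slope' self_notMem_Ioi, ← hmap, tendsto_map'_iff]
  simp only [Function.comp_def, slope_def_module, add_sub_cancel_left]

lemma hasDerivWithinAt_integral_Ici [CompleteSpace E] {f : ℝ → E} {c t : ℝ}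
    (hf : ContinuousOn f (Ici c)) (ht : c ≤ t) :
    HasDerivWithinAt (fun r => ∫ s in c..r, f s) (f t) (Ici c) t := by
  have htc : t ∈ Icc c (t + 1) := ⟨ht, by linarith⟩
  have := Fact.mk htc
  have hIcc := hf.mono (Icc_subset_Ici_self : Icc c (t + 1) ⊆ Ici c)
  refine HasDerivWithinAt.mono_of_mem_nhdsWithin (t := Icc c (t + 1)) ?_ ?_
  · exact intervalIntegral.integral_hasDerivWithinAt_right
      ((hf.mono Icc_subset_Ici_self).intervalIntegrable_of_Icc ht)
      (hIcc.stronglyMeasurableAtFilter_nhdsWithin measurableSet_Icc t) (hIcc t htc)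
  · rw [← Ici_inter_Iic]
    exact inter_mem_nhdsWithin _ (Iic_mem_nhds (by linarith))

end OneSidedDeriv

section Semigroup

variable {X : Type*} [NormedAddCommGroup X] [NormedSpace ℝ X] {S : ℝ → X →L[ℝ] X}
  {G : X → X → Prop} {x y : X} {s t : ℝ}

namespace IsGenerator

lemma sub (hG : IsGenerator S G) {x' y' : X} (h : G x y) (h' : G x' y') :
    G (x - x') (y - y') := by
  rw [hG] at h h' ⊢
  refine (h.sub h').congr fun r => ?_
  rw [map_sub, ← smul_sub, sub_sub_sub_comm]

lemma smul (hG : IsGenerator S G) (c : ℝ) (h : G x y) : G (c • x) (c • y) := by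
  rw [hG] at h ⊢
  refine (h.const_smul c).congr fun r => ?_
  rw [map_smul, ← smul_sub, smul_comm]

end IsGenerator

namespace IsContractionSemigroup

lemma norm_apply_le (hS : IsContractionSemigroup S) (ht : 0 ≤ t) (x : X) : ‖S t x‖ ≤ ‖x‖ :=
  ((S t).le_of_opNorm_le (hS.norm_le t ht) x).trans (one_mul _).le

lemma zero_apply (hS : IsContractionSemigroup S) (x : X) : S 0 x = x := by
  rw [hS.zero]
  rfl

lemma add_apply (hS : IsContractionSemigroup S) (hs : 0 ≤ s) (ht : 0 ≤ t) (x : X) :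
    S (s + t) x = S s (S t x) := by
  rw [hS.add s t hs ht]
  rfl

lemma comm_apply (hS : IsContractionSemigroup S) (hs : 0 ≤ s) (ht : 0 ≤ t) (x : X) :
    S s (S t x) = S t (S s x) := by
  rw [← hS.add_apply hs ht, ← hS.add_apply ht hs, add_comm]

lemma norm_sub_le (hS : IsContractionSemigroup S) (hs : 0 ≤ s) (ht : 0 ≤ t) (x : X) :
    ‖S t x - S s x‖ ≤ ‖S |t - s| x - x‖ := by
  wlog hst : s ≤ t generalizing s t
  · rw [norm_sub_rev, abs_sub_comm]
    exact this ht hs (le_of_not_ge hst)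
  have hshift : S t x - S s x = S s (S (t - s) x - x) := by
    rw [map_sub, ← hS.add_apply hs (sub_nonneg.2 hst), add_sub_cancel]
  rw [hshift, abs_of_nonneg (sub_nonneg.2 hst)]
  exact hS.norm_apply_le hs _

lemma continuousOn (hS : IsContractionSemigroup S) (x : X) :
    ContinuousOn (fun t => S t x) (Ici 0) := by
  have hzero : ContinuousWithinAt (fun t => S t x) (Ici 0) 0 := by
    rw [← continuousWithinAt_Ioi_iff_Ici, ContinuousWithinAt, hS.zero_apply]
    exact hS.tendsto x
  rw [ContinuousWithinAt, hS.zero_apply, tendsto_iff_norm_sub_tendsto_zero] at hzero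
  intro s hs
  rw [ContinuousWithinAt, tendsto_iff_norm_sub_tendsto_zero]
  have habs : Tendsto (fun t => |t - s|) (𝓝[Ici 0] s) (𝓝[≥] 0) := by
    refine tendsto_nhdsWithin_iff.2 ⟨?_, Eventually.of_forall fun t => mem_Ici.2 (abs_nonneg _)⟩
    have hcont : Continuous fun t => |t - s| := by fun_prop
    simpa only [sub_self, abs_zero] using (hcont.tendsto s).mono_left nhdsWithin_le_nhds
  refine squeeze_zero' (Eventually.of_forall fun _ => norm_nonneg _) ?_ (hzero.comp habs)
  filter_upwards [self_mem_nhdsWithin] with t ht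
  exact hS.norm_sub_le hs ht x

lemma intervalIntegrable (hS : IsContractionSemigroup S) (x : X) (hs : 0 ≤ s) (ht : 0 ≤ t) :
    IntervalIntegrable (fun r => S r x) volume s t :=
  ((hS.continuousOn x).mono fun _ hr => (le_min hs ht).trans hr.1).intervalIntegrable

lemma generator_apply (hS : IsContractionSemigroup S) (hG : IsGenerator S G) (h : G x y)
    (ht : 0 ≤ t) : G (S t x) (S t y) := by
  rw [hG]
  refine (((S t).continuous.tendsto y).comp ((hG x y).1 h)).congr' ?_
  filter_upwards [self_mem_nhdsWithin] with r hr
  simp only [Function.comp_apply, map_smul, map_sub, hS.comm_apply ht (le_of_lt hr)]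

lemma hasDerivWithinAt_Ioi (hS : IsContractionSemigroup S) (hG : IsGenerator S G) (h : G x y)
    (ht : 0 ≤ t) : HasDerivWithinAt (fun s => S s x) (S t y) (Ioi t) t := by
  rw [hasDerivWithinAt_Ioi_iff_tendsto_inv_smul]
  refine ((hG _ _).1 (hS.generator_apply hG h ht)).congr' ?_
  filter_upwards [self_mem_nhdsWithin] with r hr
  rw [add_comm, hS.add_apply (le_of_lt hr) ht]

variable [CompleteSpace X]

lemma integral_eq_sub (hS : IsContractionSemigroup S) (hG : IsGenerator S G) (h : G x y)
    (ht : 0 ≤ t) : ∫ s in (0 : ℝ)..t, S s y = S t x - x := by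
  have hftc := intervalIntegral.integral_eq_sub_of_hasDeriv_right_of_le ht
    ((hS.continuousOn x).mono Icc_subset_Ici_self)
    (fun s hs => hS.hasDerivWithinAt_Ioi hG h hs.1.le) (hS.intervalIntegrable y le_rfl ht)
  rwa [hS.zero_apply] at hftc

lemma hasDerivWithinAt (hS : IsContractionSemigroup S) (hG : IsGenerator S G) (h : G x y)
    (ht : 0 ≤ t) : HasDerivWithinAt (fun s => S s x) (S t y) (Ici 0) t := by
  refine ((hasDerivWithinAt_integral_Ici (hS.continuousOn y) ht).add_const x).congr
    (fun s hs => ?_) ?_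
  · rw [hS.integral_eq_sub hG h hs, sub_add_cancel]
  · rw [hS.integral_eq_sub hG h ht, sub_add_cancel]

lemma tendsto_inv_smul_integral (hS : IsContractionSemigroup S) (x : X) (ht : 0 ≤ t) :
    Tendsto (fun r => r⁻¹ • ∫ s in t..t + r, S s x) (𝓝[>] 0) (𝓝 (S t x)) := by
  have hderiv := hasDerivWithinAt_integral_Ici
    ((hS.continuousOn x).mono (Ici_subset_Ici.2 ht)) le_rfl
  simpa only [intervalIntegral.integral_same, sub_zero] using
    hasDerivWithinAt_Ioi_iff_tendsto_inv_smul.1 (hderiv.mono Ioi_subset_Ici_self)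

lemma apply_integral (hS : IsContractionSemigroup S) (x : X) (hs : 0 ≤ s) (ht : 0 ≤ t) :
    S s (∫ r in (0 : ℝ)..t, S r x) = ∫ r in s..t + s, S r x := by
  rw [← (S s).intervalIntegral_comp_comm (hS.intervalIntegrable x le_rfl ht)]
  have hadd : ∫ r in (0 : ℝ)..t, S s (S r x) = ∫ r in (0 : ℝ)..t, S (r + s) x := by
    refine intervalIntegral.integral_congr fun r hr => ?_
    rw [uIcc_of_le ht] at hr
    rw [add_comm r s, hS.add_apply hs hr.1]
  rw [hadd, intervalIntegral.integral_comp_add_right (fun r => S r x), zero_add]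

lemma generator_integral (hS : IsContractionSemigroup S) (hG : IsGenerator S G) (x : X)
    (ht : 0 ≤ t) : G (∫ s in (0 : ℝ)..t, S s x) (S t x - x) := by
  rw [hG]
  have hslope := (hS.tendsto_inv_smul_integral x ht).sub (hS.tendsto_inv_smul_integral x le_rfl)
  rw [hS.zero_apply] at hslope
  refine hslope.congr' ?_
  filter_upwards [self_mem_nhdsWithin] with r (hr : 0 < r)
  rw [hS.apply_integral x hr.le ht, ← smul_sub, zero_add]
  rw [intervalIntegral.integral_interval_sub_interval_comm'
    (hS.intervalIntegrable x ht (add_nonneg ht hr.le))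
    (hS.intervalIntegrable x le_rfl hr.le) (hS.intervalIntegrable x ht le_rfl)]

lemma exists_generator_norm_sub_lt (hS : IsContractionSemigroup S) (hG : IsGenerator S G) (x : X)
    {ε : ℝ} (hε : 0 < ε) : ∃ p y, G p y ∧ ‖p - x‖ < ε := by
  have hlim := hS.tendsto_inv_smul_integral x le_rfl
  rw [hS.zero_apply, tendsto_iff_norm_sub_tendsto_zero] at hlim
  obtain ⟨t, ht, ht0⟩ := ((hlim.eventually_lt_const hε).and self_mem_nhdsWithin).exists
  rw [zero_add] at ht
  exact ⟨_, _, hG.smul t⁻¹ (hS.generator_integral hG x (le_of_lt ht0)), ht⟩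

lemma exists_generator_tendsto (hS : IsContractionSemigroup S) (hG : IsGenerator S G) (x : X) :
    ∃ P W : ℕ → X, (∀ n, G (P n) (W n)) ∧ Tendsto P atTop (𝓝 x) ∧
      ∀ N n m, N ≤ n → N ≤ m → ‖P n - P m‖ < 2 * (1 / 2 : ℝ) ^ N := by
  have hdense : ∀ n : ℕ, ∃ p y, G p y ∧ ‖p - x‖ < (1 / 2 : ℝ) ^ n := fun n =>
    hS.exists_generator_norm_sub_lt hG x (by positivity)
  choose P W hPW hlt using hdense
  refine ⟨P, W, hPW, ?_, fun N n m hn hm => ?_⟩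
  · rw [tendsto_iff_norm_sub_tendsto_zero]
    exact squeeze_zero (fun n => norm_nonneg _) (fun n => (hlt n).le)
      (tendsto_pow_atTop_nhds_zero_of_lt_one (by norm_num) (by norm_num))
  · have hlt' : ∀ k, N ≤ k → ‖P k - x‖ < (1 / 2 : ℝ) ^ N := fun k hk =>
      (hlt k).trans_le (pow_le_pow_of_le_one (by norm_num) (by norm_num) hk)
    calc ‖P n - P m‖ = ‖(P n - x) - (P m - x)‖ := by rw [sub_sub_sub_cancel_right]
      _ ≤ ‖P n - x‖ + ‖P m - x‖ := _root_.norm_sub_le _ _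
      _ < 2 * (1 / 2 : ℝ) ^ N := by linarith [hlt' n hn, hlt' m hm]

end IsContractionSemigroup

end Semigroup

/-! ### Orbits in the domain of the wave operator -/

section Orbit

variable {a : ℝ → ℝ} {ha : IsDegenerateCoeff a}

lemma norm_sq_energySpace (U : EnergySpace ha) : ‖U‖ ^ 2 = ‖U.fst‖ ^ 2 + ‖U.snd‖ ^ 2 :=
  WithLp.prod_norm_sq_eq_of_L2 U

/-- The functional `2 ∫ x u' v` on the energy space, which tests the wave equation against the
multiplier `x u'`. -/
noncomputable def multiplierForm (U : EnergySpace ha) : ℝ :=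
  2 * inner ℝ (weightMul ha (H1.gradL ha U.fst)) U.snd

/-- The functional `∫ u v` on the energy space, which tests the wave equation against `u` and
measures the defect of equipartition between kinetic and potential energy. -/
noncomputable def productForm (U : EnergySpace ha) : ℝ :=
  inner ℝ (H1.toL2L ha U.fst) U.snd

lemma abs_multiplierForm_le (U : EnergySpace ha) :
    |multiplierForm U| ≤ 1 / min 1 (a 1) * ‖U‖ ^ 2 := by
  have hmin := ha.min_one_pos
  have hone : 1 ≤ 1 / min 1 (a 1) := (one_le_div hmin).2 (min_le_left _ _)
  have hinv : 1 / a 1 ≤ 1 / min 1 (a 1) := one_div_le_one_div_of_le hmin (min_le_right _ _)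
  have hweight : ‖weightMul ha (H1.gradL ha U.fst)‖ ^ 2 ≤ 1 / a 1 * ‖U.fst‖ ^ 2 := by
    have hsq := pow_le_pow_left₀ (norm_nonneg _) (norm_weightMul_le ha (H1.gradL ha U.fst)) 2
    rwa [(H1.gradL ha).norm_map, mul_pow, inv_pow, Real.sq_sqrt ha.pos_one.le, ← one_div] at hsq
  calc |multiplierForm U|
      = 2 * |inner ℝ (weightMul ha (H1.gradL ha U.fst)) U.snd| := by
        rw [multiplierForm, abs_mul, abs_two]
    _ ≤ 2 * (‖weightMul ha (H1.gradL ha U.fst)‖ * ‖U.snd‖) := by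
        gcongr
        exact abs_real_inner_le_norm _ _
    _ ≤ ‖weightMul ha (H1.gradL ha U.fst)‖ ^ 2 + ‖U.snd‖ ^ 2 := by
        rw [← mul_assoc]
        exact two_mul_le_add_sq _ _
    _ ≤ 1 / min 1 (a 1) * ‖U.fst‖ ^ 2 + 1 / min 1 (a 1) * ‖U.snd‖ ^ 2 :=
        add_le_add (hweight.trans (mul_le_mul_of_nonneg_right hinv (sq_nonneg _)))
          (le_mul_of_one_le_left (sq_nonneg _) hone)
    _ = 1 / min 1 (a 1) * ‖U‖ ^ 2 := by rw [norm_sq_energySpace, mul_add]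

lemma abs_productForm_le (U : EnergySpace ha) :
    |productForm U| ≤ √(poincareConst a) * ‖U‖ ^ 2 := by
  calc |productForm U| ≤ ‖U.fst.toL2‖ * ‖U.snd‖ := abs_real_inner_le_norm _ _
    _ ≤ √(poincareConst a) * ‖U‖ * ‖U‖ := by
        gcongr
        · exact U.fst.norm_toL2_le.trans (by gcongr; exact WithLp.norm_fst_le _ U)
        · exact WithLp.norm_snd_le _ U
    _ = √(poincareConst a) * ‖U‖ ^ 2 := by ring

/-- The factor `(2 - μ_a) T - 4 / min {1, a(1)} - 2 μ_a √C_a` in the observability inequality. -/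
noncomputable def observabilityGain (a : ℝ → ℝ) (T : ℝ) : ℝ :=
  (2 - mu a) * T - 4 / min 1 (a 1) - 2 * mu a * √(poincareConst a)

namespace WaveOp

section Graph

variable {U W : EnergySpace ha}

lemma mul_normalDeriv_eq (h : WaveOp ha U W) : a 1 * U.fst.normalDeriv =
    inner ℝ ((memLp_sqrt ha).toLp _) (H1.gradL ha U.fst) + inner ℝ (memLp_id.toLp _) W.snd := by
  obtain ⟨g, hg⟩ := hasFluxDeriv_iff.1 h.2
  exact hg.mul_normalDeriv_eq_inner

lemma inner_eq_zero (h : WaveOp ha U W) : inner ℝ U W = 0 := by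
  obtain ⟨g, hg⟩ := hasFluxDeriv_iff.1 h.2
  rw [WithLp.prod_inner_apply]
  change inner ℝ U.fst W.fst + inner ℝ U.snd W.snd = 0
  rw [h.1, hg.inner_toL2, H1.inner_eq_grad, real_inner_comm, add_neg_cancel]

lemma le_mul_normalDeriv_sq (h : WaveOp ha U W) :
    2 * inner ℝ (weightMul ha (H1.gradL ha U.fst)) W.snd - ‖U.snd‖ ^ 2
        + mu a / 2 * (‖U.snd‖ ^ 2 - ‖U.fst‖ ^ 2) + (1 - mu a / 2) * ‖U‖ ^ 2
      ≤ a 1 * U.fst.normalDeriv ^ 2 := by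
  obtain ⟨g, hg⟩ := hasFluxDeriv_iff.1 h.2
  rw [norm_sq_energySpace, H1.gradL_apply]
  linarith [hg.one_sub_mu_mul_le_multiplier]

lemma mul_normalDeriv_sq_le (h : WaveOp ha U W) : a 1 * U.fst.normalDeriv ^ 2 ≤
    2 * inner ℝ (weightMul ha (H1.gradL ha U.fst)) W.snd - ‖U.snd‖ ^ 2 + 3 * ‖U‖ ^ 2 := by
  obtain ⟨g, hg⟩ := hasFluxDeriv_iff.1 h.2
  rw [norm_sq_energySpace, H1.gradL_apply]
  linarith [hg.multiplier_le, sq_nonneg ‖U.snd‖]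

end Graph

variable {S : ℝ → EnergySpace ha →L[ℝ] EnergySpace ha} {P W : EnergySpace ha} {t T : ℝ}
  (h : WaveOp ha P W) (hS : IsContractionSemigroup S) (hG : IsGenerator S (WaveOp ha))

include h hS hG

lemma hasDerivWithinAt_fst (ht : 0 ≤ t) :
    HasDerivWithinAt (fun s => (S s P).fst) (S t W).fst (Ici 0) t :=
  (WithLp.fstL 2 ℝ (H1 ha) L2).hasFDerivAt.comp_hasDerivWithinAt t (hS.hasDerivWithinAt hG h ht)

lemma hasDerivWithinAt_snd (ht : 0 ≤ t) :
    HasDerivWithinAt (fun s => (S s P).snd) (S t W).snd (Ici 0) t :=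
  (WithLp.sndL 2 ℝ (H1 ha) L2).hasFDerivAt.comp_hasDerivWithinAt t (hS.hasDerivWithinAt hG h ht)

lemma hasDerivWithinAt_toL2L_fst (ht : 0 ≤ t) :
    HasDerivWithinAt (fun s => H1.toL2L ha (S s P).fst) (S t P).snd (Ici 0) t := by
  rw [(hS.generator_apply hG h ht).1]
  exact (H1.toL2L ha).hasFDerivAt.comp_hasDerivWithinAt t (h.hasDerivWithinAt_fst hS hG ht)

lemma hasDerivWithinAt_multiplierForm (ht : 0 ≤ t) :
    HasDerivWithinAt (fun s => multiplierForm (S s P))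
      (2 * inner ℝ (weightMul ha (H1.gradL ha (S t P).fst)) (S t W).snd - ‖(S t P).snd‖ ^ 2)
      (Ici 0) t := by
  have hmul : HasDerivWithinAt (fun s => weightMul ha (H1.gradL ha (S s P).fst))
      (weightMul ha (H1.gradL ha (S t W).fst)) (Ici 0) t :=
    (weightMul ha ∘L (H1.gradL ha).toContinuousLinearMap).hasFDerivAt.comp_hasDerivWithinAt t
      (h.hasDerivWithinAt_fst hS hG ht)
  refine ((hmul.inner ℝ (h.hasDerivWithinAt_snd hS hG ht)).const_mul 2).congr_deriv ?_
  rw [(hS.generator_apply hG h ht).1, mul_add, H1.gradL_apply (S t W).fst,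
    (S t W).fst.two_inner_weightMul_grad, sub_eq_add_neg]

lemma hasDerivWithinAt_productForm (ht : 0 ≤ t) :
    HasDerivWithinAt (fun s => productForm (S s P))
      (‖(S t P).snd‖ ^ 2 - ‖(S t P).fst‖ ^ 2) (Ici 0) t := by
  obtain ⟨g, hg⟩ := hasFluxDeriv_iff.1 (hS.generator_apply hG h ht).2
  refine ((h.hasDerivWithinAt_toL2L_fst hS hG ht).inner ℝ
    (h.hasDerivWithinAt_snd hS hG ht)).congr_deriv ?_
  rw [H1.toL2L_apply, hg.inner_toL2, real_inner_self_eq_norm_sq, real_inner_self_eq_norm_sq,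
    ← H1.norm_eq_grad, add_comm, sub_eq_add_neg]

lemma norm_sq_apply_eq (ht : 0 ≤ t) : ‖S t P‖ ^ 2 = ‖P‖ ^ 2 := by
  have hcont : ContinuousOn (fun s => ‖S s P‖ ^ 2) (Icc 0 t) :=
    ((hS.continuousOn P).mono Icc_subset_Ici_self).norm.pow 2
  have hderiv : ∀ s ∈ Ico 0 t, HasDerivWithinAt (fun s => ‖S s P‖ ^ 2) 0 (Ici s) s := fun s hs => by
    have hsq := (hS.hasDerivWithinAt hG h hs.1).norm_sq
    rw [(hS.generator_apply hG h hs.1).inner_eq_zero, mul_zero] at hsq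
    exact hsq.mono (Ici_subset_Ici.2 hs.1)
  rw [constant_of_has_deriv_right_zero hcont hderiv t ⟨ht, le_rfl⟩, hS.zero_apply]

lemma continuousOn_normalDeriv : ContinuousOn (fun t => (S t P).fst.normalDeriv) (Ici 0) := by
  have hgrad := (H1.gradL ha).continuous.comp_continuousOn
    ((WithLp.fstL 2 ℝ (H1 ha) L2).continuous.comp_continuousOn (hS.continuousOn P))
  have hsnd := (WithLp.sndL 2 ℝ (H1 ha) L2).continuous.comp_continuousOn (hS.continuousOn W)
  have hmul : ContinuousOn (fun t => a 1 * (S t P).fst.normalDeriv) (Ici 0) :=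
    (((continuousOn_const (c := (memLp_sqrt ha).toLp _)).inner hgrad).add
      ((continuousOn_const (c := memLp_id.toLp _)).inner hsnd)).congr
        fun t ht => (hS.generator_apply hG h ht).mul_normalDeriv_eq
  simpa only [inv_mul_cancel_left₀ ha.pos_one.ne'] using hmul.const_mul (a 1)⁻¹

lemma integrableOn_normalDeriv_sq (T : ℝ) :
    IntegrableOn (fun t => a 1 * (S t P).fst.normalDeriv ^ 2) (Icc 0 T) :=
  (continuousOn_const.mul (((h.continuousOn_normalDeriv hS hG).mono
    Icc_subset_Ici_self).pow 2)).integrableOn_Icc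

lemma observability (hT : 0 ≤ T) :
    observabilityGain a T * (1 / 2 * ‖P‖ ^ 2) ≤
      a 1 * ∫ t in (0 : ℝ)..T, (S t P).fst.normalDeriv ^ 2 := by
  have hderiv : ∀ t : ℝ, 0 ≤ t → HasDerivWithinAt (fun t => multiplierForm (S t P) +
      mu a / 2 * productForm (S t P) + (1 - mu a / 2) * ‖P‖ ^ 2 * t) _ (Ici 0) t := fun t ht =>
    ((h.hasDerivWithinAt_multiplierForm hS hG ht).fun_add
      ((h.hasDerivWithinAt_productForm hS hG ht).const_mul (mu a / 2))).fun_add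
      ((hasDerivWithinAt_id t (Ici 0)).const_mul ((1 - mu a / 2) * ‖P‖ ^ 2))
  have hintegral := intervalIntegral.sub_le_integral_of_hasDeriv_right_of_le hT
    (fun t ht => (hderiv t ht.1).continuousWithinAt.mono Icc_subset_Ici_self)
    (fun t ht => (hderiv t ht.1.le).mono fun s hs => ht.1.le.trans (le_of_lt hs))
    (h.integrableOn_normalDeriv_sq hS hG T) (fun t ht => by
      have hle := (hS.generator_apply hG h ht.1.le).le_mul_normalDeriv_sq
      rwa [h.norm_sq_apply_eq hS hG ht.1.le, ← mul_one ((1 - mu a / 2) * _)] at hle)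
  rw [← intervalIntegral.integral_const_mul]
  refine le_trans ?_ hintegral
  have hmulT := (abs_le.1 (abs_multiplierForm_le (S T P))).1
  have hmul0 := (abs_le.1 (abs_multiplierForm_le P)).2
  have hprodT := mul_le_mul_of_nonneg_left (abs_le.1 (abs_productForm_le (S T P))).1 ha.mu_nonneg
  have hprod0 := mul_le_mul_of_nonneg_left (abs_le.1 (abs_productForm_le P)).2 ha.mu_nonneg
  rw [h.norm_sq_apply_eq hS hG hT] at hmulT hprodT
  rw [hS.zero_apply, observabilityGain, div_eq_mul_one_div 4]
  linarith

lemma hidden_regularity (hT : 0 ≤ T) :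
    a 1 * ∫ t in (0 : ℝ)..T, (S t P).fst.normalDeriv ^ 2 ≤
      (3 * T + 2 / min 1 (a 1)) * ‖P‖ ^ 2 := by
  have hderiv : ∀ t : ℝ, 0 ≤ t → HasDerivWithinAt (fun t => multiplierForm (S t P) +
      3 * ‖P‖ ^ 2 * t) _ (Ici 0) t := fun t ht =>
    (h.hasDerivWithinAt_multiplierForm hS hG ht).fun_add
      ((hasDerivWithinAt_id t (Ici 0)).const_mul (3 * ‖P‖ ^ 2))
  have hintegral := intervalIntegral.integral_le_sub_of_hasDeriv_right_of_le hT
    (fun t ht => (hderiv t ht.1).continuousWithinAt.mono Icc_subset_Ici_self)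
    (fun t ht => (hderiv t ht.1.le).mono fun s hs => ht.1.le.trans (le_of_lt hs))
    (h.integrableOn_normalDeriv_sq hS hG T) (fun t ht => by
      have hle := (hS.generator_apply hG h ht.1.le).mul_normalDeriv_sq_le
      rwa [h.norm_sq_apply_eq hS hG ht.1.le, ← mul_one (3 * _)] at hle)
  rw [← intervalIntegral.integral_const_mul]
  refine hintegral.trans ?_
  have hmulT := (abs_le.1 (abs_multiplierForm_le (S T P))).2
  have hmul0 := (abs_le.1 (abs_multiplierForm_le P)).1
  rw [h.norm_sq_apply_eq hS hG hT] at hmulT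
  rw [hS.zero_apply, div_eq_mul_one_div 2]
  linarith

lemma isClassicalSolution : IsClassicalSolution ha P.fst P.snd (fun t => (S t P).fst) := by
  have htime : ∀ t ∈ Ici (0 : ℝ), timeDeriv (fun s => (S s P).fst) t = (S t P).snd := fun t ht =>
    (h.hasDerivWithinAt_toL2L_fst hS hG ht).derivWithin (uniqueDiffOn_Ici 0 t ht)
  refine ⟨⟨?_, ?_, S, hS, hG, fun t ht => ?_⟩, W, h⟩
  · rw [contDiffOn_one_iff_derivWithin (uniqueDiffOn_Ici 0)]
    exact ⟨fun t ht => (h.hasDerivWithinAt_toL2L_fst hS hG ht).differentiableWithinAt,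
      ((WithLp.sndL 2 ℝ (H1 ha) L2).continuous.comp_continuousOn (hS.continuousOn P)).congr htime⟩
  · exact (WithLp.fstL 2 ℝ (H1 ha) L2).continuous.comp_continuousOn (hS.continuousOn P)
  · rw [htime t ht]
    rfl

end WaveOp

lemma IsClassicalSolution.exists_semigroup {p : H1 ha} {q : L2} {v : ℝ → H1 ha}
    (hv : IsClassicalSolution ha p q v) :
    ∃ (S : ℝ → EnergySpace ha →L[ℝ] EnergySpace ha) (W : EnergySpace ha),
      IsContractionSemigroup S ∧ IsGenerator S (WaveOp ha) ∧ WaveOp ha (WithLp.toLp 2 (p, q)) W ∧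
      ∀ t : ℝ, 0 ≤ t → v t = (S t (WithLp.toLp 2 (p, q))).fst := by
  obtain ⟨⟨-, -, S, hS, hG, heq⟩, W, hW⟩ := hv
  exact ⟨S, W, hS, hG, hW, fun t ht => congrArg WithLp.fst (heq t ht)⟩

lemma IsMildSolution.energy_zero {u₀ : H1 ha} {u₁ : L2} {u : ℝ → H1 ha}
    (hu : IsMildSolution ha u₀ u₁ u) : energy u 0 = 1 / 2 * (‖u₀‖ ^ 2 + ‖u₁‖ ^ 2) := by
  obtain ⟨S, hS, -, heq⟩ := hu.semigroup
  have hinit := heq 0 le_rfl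
  rw [hS.zero_apply] at hinit
  have hfst : u 0 = u₀ := congrArg WithLp.fst hinit
  have hsnd : timeDeriv u 0 = u₁ := congrArg WithLp.snd hinit
  rw [energy, hfst, hsnd, H1.norm_eq_grad, norm_sq_eq_integral u₀.grad_ae_eq,
    norm_sq_eq_integral (EventuallyEq.refl _ u₁),
    ← integral_add u₀.isH1_rep.memLp_deriv.integrable_sq (Lp.memLp u₁).integrable_sq]
  congr 1
  refine integral_congr_ae (ae_vol01 fun x hx => ?_)
  simp only [mul_pow, Real.sq_sqrt (ha.pos x ⟨hx.1, hx.2.le⟩).le, add_comm]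

end Orbit

/-! ### Convergence in `Lᵖ` -/

section Lp

variable {α E : Type*} [MeasurableSpace α] [NormedAddCommGroup E] {μ : Measure α}

lemma eLpNorm_two_le {f : α → ℝ} (hf : MemLp f 2 μ) {C : ℝ} (hC : 0 ≤ C)
    (h : ∫ x, f x ^ 2 ∂μ ≤ C ^ 2) : eLpNorm f 2 μ ≤ ENNReal.ofReal C := by
  rw [← ENNReal.ofReal_toReal hf.eLpNorm_ne_top, ← Lp.norm_toLp f hf]
  rw [← norm_sq_eq_integral hf.coeFn_toLp] at h
  exact ENNReal.ofReal_le_ofReal (le_of_sq_le_sq h hC)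

lemma tendsto_integral_sq {F : ℕ → α → ℝ} {f : α → ℝ} (hF : ∀ n, MemLp (F n) 2 μ)
    (hf : MemLp f 2 μ) (h : Tendsto (fun n => eLpNorm (F n - f) 2 μ) atTop (𝓝 0)) :
    Tendsto (fun n => ∫ x, F n x ^ 2 ∂μ) atTop (𝓝 (∫ x, f x ^ 2 ∂μ)) := by
  have hnorm := ((Lp.tendsto_Lp_iff_tendsto_eLpNorm'' F hF f hf).2 h).norm.pow 2
  simpa only [norm_sq_eq_integral (MemLp.coeFn_toLp _)] using hnorm

lemma memLp_of_continuousOn_Ici {f : ℝ → E} {s : ℝ} (hf : ContinuousOn f (Ici s)) (t : ℝ)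
    (p : ENNReal) : MemLp f p (volume.restrict (Ioc s t)) := by
  have hIcc : ContinuousOn f (Icc s t) := hf.mono Icc_subset_Ici_self
  obtain ⟨C, hC⟩ := isCompact_Icc.exists_bound_of_continuousOn hIcc
  refine MemLp.of_bound
    ((hIcc.mono Ioc_subset_Icc_self).aestronglyMeasurable measurableSet_Ioc) C ?_
  filter_upwards [ae_restrict_mem measurableSet_Ioc] with x hx
  exact hC x (Ioc_subset_Icc_self hx)

lemma exists_common_limit_of_cauchy_eLpNorm [CompleteSpace E] {ι : Type*} {ν : ι → Measure α}
    {p : ENNReal} (hp : 1 ≤ p) {F : ℕ → α → E} (hF : ∀ i n, MemLp (F n) p (ν i))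
    {B : ι → ℕ → ENNReal} (hB : ∀ i, ∑' n, B i n ≠ ⊤)
    (hcauchy : ∀ i N n m, N ≤ n → N ≤ m → eLpNorm (F n - F m) p (ν i) < B i N) :
    ∃ f : α → E, ∀ i, MemLp f p (ν i) ∧
      Tendsto (fun n => eLpNorm (F n - f) p (ν i)) atTop (𝓝 0) := by
  -- The pointwise limit does not depend on the measure, and summability of the bounds makes it
  -- exist almost everywhere.
  refine ⟨fun x => limUnder atTop fun n => F n x, fun i => ?_⟩
  have hmeas := fun n => (hF i n).aestronglyMeasurable
  have hae : ∀ᵐ x ∂ν i, Tendsto (fun n => F n x) atTop (𝓝 (limUnder atTop fun n => F n x)) :=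
    (Lp.ae_tendsto_of_cauchy_eLpNorm hmeas hp (hB i) (hcauchy i)).mono fun x hx =>
      tendsto_nhds_limUnder hx
  have hlim := Lp.cauchy_tendsto_of_tendsto hmeas _ (hB i) (hcauchy i) hae
  exact ⟨Lp.memLp_of_cauchy_tendsto hp (hF i) _
    (aestronglyMeasurable_of_tendsto_ae atTop hmeas hae) hlim, hlim⟩

end Lp

/-! ### The normal trace of mild solutions -/

section Trace

variable {a : ℝ → ℝ} {ha : IsDegenerateCoeff a}

namespace WaveOp

variable {S : ℝ → EnergySpace ha →L[ℝ] EnergySpace ha} {P W P' W' : EnergySpace ha}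

lemma normalDeriv_sub (hG : IsGenerator S (WaveOp ha)) (h : WaveOp ha P W)
    (h' : WaveOp ha P' W') :
    (P - P').fst.normalDeriv = P.fst.normalDeriv - P'.fst.normalDeriv := by
  refine mul_left_cancel₀ ha.pos_one.ne' ?_
  rw [mul_sub, h.mul_normalDeriv_eq, h'.mul_normalDeriv_eq, mul_normalDeriv_eq (hG.sub h h'),
    WithLp.sub_fst, WithLp.sub_snd, map_sub, inner_sub_right, inner_sub_right, add_sub_add_comm]

lemma eLpNorm_normalDeriv_sub_le (h : WaveOp ha P W) (h' : WaveOp ha P' W')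
    (hS : IsContractionSemigroup S) (hG : IsGenerator S (WaveOp ha)) {T : ℝ} (hT : 0 ≤ T) :
    eLpNorm ((fun t => (S t P).fst.normalDeriv) - fun t => (S t P').fst.normalDeriv) 2
      (volume.restrict (Ioc 0 T)) ≤
      ENNReal.ofReal (√((3 * T + 2 / min 1 (a 1)) / a 1) * ‖P - P'‖) := by
  have hmin := ha.min_one_pos
  have hK : 0 ≤ (3 * T + 2 / min 1 (a 1)) / a 1 := div_nonneg (by positivity) ha.pos_one.le
  refine eLpNorm_two_le ((memLp_of_continuousOn_Ici (h.continuousOn_normalDeriv hS hG) T 2).sub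
    (memLp_of_continuousOn_Ici (h'.continuousOn_normalDeriv hS hG) T 2)) (by positivity) ?_
  have hsub : ∫ t in Ioc 0 T, ((fun t => (S t P).fst.normalDeriv) -
      fun t => (S t P').fst.normalDeriv) t ^ 2 =
      ∫ t in Ioc 0 T, (S t (P - P')).fst.normalDeriv ^ 2 :=
    setIntegral_congr_fun measurableSet_Ioc fun t ht => by
      simp only [Pi.sub_apply, map_sub, normalDeriv_sub hG (hS.generator_apply hG h ht.1.le)
        (hS.generator_apply hG h' ht.1.le)]
  have hreg := hidden_regularity (hG.sub h h') hS hG hT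
  rw [intervalIntegral.integral_of_le hT, ← hsub] at hreg
  rwa [mul_pow, Real.sq_sqrt hK, div_mul_eq_mul_div, le_div_iff₀' ha.pos_one]

end WaveOp

variable {u₀ : H1 ha} {u₁ : L2} {u : ℝ → H1 ha} {g : ℝ → ℝ} {T : ℝ}

theorem IsMildSolution.exists_isNormalTrace (hu : IsMildSolution ha u₀ u₁ u) :
    ∃ g : ℝ → ℝ, IsNormalTrace ha u₀ u₁ g := by
  obtain ⟨S, hS, hG, -⟩ := hu.semigroup
  obtain ⟨P, W, hPW, hP, hcauchy⟩ := hS.exists_generator_tendsto hG (WithLp.toLp 2 (u₀, u₁))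
  have hmin := ha.min_one_pos
  let K : {T : ℝ // 0 ≤ T} → ℝ := fun T => √((3 * T + 2 / min 1 (a 1)) / a 1)
  have hK : ∀ T, 0 < K T := fun T => Real.sqrt_pos.2 <| div_pos
    (add_pos_of_nonneg_of_pos (mul_nonneg three_pos.le T.2) (by positivity)) ha.pos_one
  obtain ⟨g, hg⟩ := exists_common_limit_of_cauchy_eLpNorm (p := 2) one_le_two
    (ν := fun T : {T : ℝ // 0 ≤ T} => volume.restrict (Ioc (0 : ℝ) T))
    (F := fun n t => (S t (P n)).fst.normalDeriv)
    (B := fun T N => ENNReal.ofReal (K T * (2 * (1 / 2 : ℝ) ^ N)))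
    (fun T n => memLp_of_continuousOn_Ici ((hPW n).continuousOn_normalDeriv hS hG) T 2)
    (fun T => ((summable_geometric_two.mul_left 2).mul_left (K T)).tsum_ofReal_ne_top)
    fun T N n m hn hm => ((hPW n).eLpNorm_normalDeriv_sub_le (hPW m) hS hG T.2).trans_lt <|
      (ENNReal.ofReal_lt_ofReal_iff (mul_pos (hK T) (by positivity))).2
        (mul_lt_mul_of_pos_left (hcauchy N n m hn hm) (hK T))
  exact ⟨g, fun T hT => (hg ⟨T, hT⟩).1, fun n => (P n).fst, fun n => (P n).snd,
    fun n t => (S t (P n)).fst, fun n => (hPW n).isClassicalSolution hS hG,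
    ((WithLp.fstL 2 ℝ (H1 ha) L2).continuous.tendsto _).comp hP,
    ((WithLp.sndL 2 ℝ (H1 ha) L2).continuous.tendsto _).comp hP, fun T hT => (hg ⟨T, hT⟩).2⟩

/-! ### Observability -/

lemma IsClassicalSolution.memLp_normalDeriv (hu : IsClassicalSolution ha u₀ u₁ u) (T : ℝ) :
    MemLp (fun t => (u t).normalDeriv) 2 (volume.restrict (Ioc 0 T)) := by
  obtain ⟨S, W, hS, hG, hW, heq⟩ := hu.exists_semigroup
  exact memLp_of_continuousOn_Ici
    ((hW.continuousOn_normalDeriv hS hG).congr fun t ht => by rw [heq t ht]) T 2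

lemma IsClassicalSolution.observability (hu : IsClassicalSolution ha u₀ u₁ u) (hT : 0 ≤ T) :
    observabilityGain a T * (1 / 2 * (‖u₀‖ ^ 2 + ‖u₁‖ ^ 2)) ≤
      a 1 * ∫ t in (0 : ℝ)..T, (u t).normalDeriv ^ 2 := by
  obtain ⟨S, W, hS, hG, hW, heq⟩ := hu.exists_semigroup
  have hobs := hW.observability hS hG hT
  rw [norm_sq_energySpace] at hobs
  rwa [intervalIntegral.integral_congr (g := fun t => (S t _).fst.normalDeriv ^ 2) fun t ht => ?_]
  rw [uIcc_of_le hT] at ht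
  simp only [heq t ht.1]

theorem IsNormalTrace.observability (hg : IsNormalTrace ha u₀ u₁ g)
    (hu : IsMildSolution ha u₀ u₁ u) (hT : 0 ≤ T) :
    observabilityGain a T * energy u 0 ≤ a 1 * ∫ t in (0 : ℝ)..T, g t ^ 2 := by
  obtain ⟨p, q, v, hv, hp, hq, hlim⟩ := hg.approx
  have henergy := (((hp.norm.pow 2).add (hq.norm.pow 2)).const_mul (1 / 2)).const_mul
    (observabilityGain a T)
  have htrace := (tendsto_integral_sq (fun n => (hv n).memLp_normalDeriv T) (hg.memLp T hT)
    (hlim T hT)).const_mul (a 1)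
  simp only [← intervalIntegral.integral_of_le hT] at htrace
  rw [hu.energy_zero]
  exact le_of_tendsto_of_tendsto' henergy htrace fun n => (hv n).observability hT

lemma observabilityTime_nonneg (ha : IsDegenerateCoeff a) : 0 ≤ observabilityTime a := by
  have hmu := ha.mu_nonneg
  have hmin := ha.min_one_pos
  have htwo := ha.two_sub_mu_pos
  rw [observabilityTime]
  positivity

lemma observabilityGain_pos (ha : IsDegenerateCoeff a) (hT : observabilityTime a < T) :
    0 < observabilityGain a T := by
  rw [observabilityTime, one_div, inv_mul_lt_iff₀ ha.two_sub_mu_pos] at hT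
  rw [observabilityGain]
  linarith

theorem isObservabilityConstant_observabilityGain (ha : IsDegenerateCoeff a)
    (hT : observabilityTime a < T) :
    IsObservabilityConstant ha T (1 / a 1 * observabilityGain a T) := by
  refine ⟨mul_pos (one_div_pos.2 ha.pos_one) (observabilityGain_pos ha hT),
    fun u₀ u₁ u g hu hg => ?_⟩
  rw [mul_assoc, one_div, inv_mul_le_iff₀ ha.pos_one]
  exact hg.observability hu ((observabilityTime_nonneg ha).trans hT.le)

end Trace

end DegWave

theorem mainTheorem1 (a : ℝ → ℝ) (ha : DegWave.IsDegenerateCoeff a) :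
    (∀ (u₀ : DegWave.H1 ha) (u₁ : DegWave.L2) (u : ℝ → DegWave.H1 ha),
      DegWave.IsMildSolution ha u₀ u₁ u →
        (∃ g : ℝ → ℝ, DegWave.IsNormalTrace ha u₀ u₁ g) ∧
        ∀ g : ℝ → ℝ, DegWave.IsNormalTrace ha u₀ u₁ g → ∀ T : ℝ, 0 ≤ T →
          a 1 * ∫ t in (0 : ℝ)..T, g t ^ 2 ≥
            ((2 - DegWave.mu a) * T - 4 / min 1 (a 1)
              - 2 * DegWave.mu a * √(DegWave.poincareConst a)) * DegWave.energy u 0) ∧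
    (∀ T : ℝ, DegWave.observabilityTime a < T →
      DegWave.IsObservable ha T ∧
      ((1 / a 1 * ((2 - DegWave.mu a) * T - 4 / min 1 (a 1)
          - 2 * DegWave.mu a * √(DegWave.poincareConst a)) : ℝ) : EReal)
        ≤ DegWave.observabilityConst ha T) := by
  refine ⟨fun u₀ u₁ u hu => ⟨hu.exists_isNormalTrace, fun g hg T hT => hg.observability hu hT⟩,
    fun T hT => ?_⟩
  have hconst := DegWave.isObservabilityConstant_observabilityGain ha hT
  exact ⟨⟨_, hconst⟩, le_sSup (mem_image_of_mem _ hconst)⟩
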